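/- **Setting.** Let $d\ge 1$, $n\ge 0$, let $D\subset\mathbb R^n$ be bounded and Borel, and let $\nu$ be a probability measure with $\nu(D)=1$. Let $y_x=f(x;\omega)\in\mathbb R^d$ and $\hat y_x=\hat f(x;\hat\omega)\in\mathbb R^d$ ($x\in D$) be random fields, jointly measurable in $x$ and the latent variable; $\mu_x$ and $\hat\mu_x$ are the laws of $y_x$ and $\hat y_x$. Let $W_2(\mu,\hat\mu)=\inf_\pi\mathbb E_{(y,\hat y)\sim\pi}[\|y-\hat y\|^2]^{1/2}$ over the couplings $\pi$ of $\mu,\hat\mu$, with $\|\cdot\|$ the Euclidean norm. Let $N\ge 1$ and $\delta>0$. The training inputs $x_1,\dots,x_N$ are i.i.d. with law $\nu$, $y_i=f(x_i;\omega_i)$ and $\hat y_i=\hat f(x_i;\hat\omega_i)$, where the pairs $(x_i,\omega_i)$ are i.i.d. with $x_i,\omega_i$ independent, and likewise the pairs $(x_i,\hat\omega_i)$. Put $$W_2^2(y_x,\hat y_x)=\int_D W_2^2(\mu_x,\hat\mu_x)\,\nu(dx),\qquad W_{2,\delta}^{2,\mathrm e}(y_x,\hat y_x)=\int_D W_2^2(\mu^{\mathrm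 e}_{x,\delta},\hat\mu^{\mathrm e}_{x,\delta})\,\nu^{\mathrm e}(dx),$$ where $\nu^{\mathrm e}$ is the empirical measure of $x_1,\dots,x_N$ and $\mu^{\mathrm e}_{x,\delta}$, $\hat\mu^{\mathrm e}_{x,\delta}$ are the empirical measures of those $y_j$, resp. $\hat y_j$, with $\|x_j-x\|\le\delta$; let $N(x,\delta)$ be the number of such $j$. $\mathbb E[h(N(x,\delta),d)]$ denotes the expectation over the training inputs and over $x$ drawn from $\nu^{\mathrm e}$, that is, $\mathbb E\big[\int_D h(N(x,\delta),d)\,\nu^{\mathrm e}(dx)\big]$. **Assumptions.** 1. $\|y_x\|^2\le M_0$ and $\|\hat y_x\|^2\le M_0$ almost surely, for all $x\in D$. 2. $W_2(\mu_x,\mu_{\tilde x})\le L\|x-\tilde x\|$ and $W_2(\hat\mu_x,\hat\mu_{\tilde x})\le L\|x-\tilde x\|$ for all $x,\tilde x\in D$, where $L\ge0$. 3. $\sigma_1\ge\dots\ge\sigma_d>0$ are numbers with $\sigma_1\le\sqrt{M_0}$ that bound the sixth moments of the coordinates: $(\int y_i^6\,\mu_x(dy))^{1/6}\le\sigma_i$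 and $(\int y_i^6\,\hat\mu_x(dy))^{1/6}\le\sigma_i$ for all $x\in D$ and all $i$. Let $$h(m,d)=\begin{cases}2m^{-1/4}\log(1+m)^{1/2},& d\le4,\\[2pt] 2\Big(m^{-1/4}+\big(\prod_{i=1}^d\tfrac{\sigma_i}{\sigma_1}\,m\big)^{-1/d}\Big),& d>4,\end{cases}$$ and, for $m_0\in\mathbb N$, let $h^{\ast}_{m_0}(m,d)=h(m,d)$ if $d\le4$ or $m<m_0$, and $$h^{\ast}_{m_0}(m,d)=2\Big(m^{-1/4}+\big(\prod_{i=1}^d\tfrac{\sigma_i}{\sigma_1}\big)^{1/d}m^{-1/d}\Big)\quad\text{if } d>4 \text{ and } m\ge m_0 .$$ **Theorem.** There are a constant $C>0$ depending only on $d$ and a number $m_0$ depending only on $d$ and $\sigma_1,\dots,\sigma_d$ such that, in every setting as above, $\big|W_2^2(y_x,\hat y_x)-W_{2,\delta}^{2,\mathrm e}(y_x,\hat y_x)\big|$ is integrable, $$\mathbb E\Big[\big|W_2^2(y_x,\hat y_x)-W_{2,\delta}^{2,\mathrm e}(y_x,\hat y_x)\big|\Big]\le\frac{4M_0}{\sqrt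 N}+8CM_0\,\mathbb E[h(N(x,\delta),d)]+8\sqrt{M_0}\,L\delta ,$$ and the same bound holds with the improved rate $h^{\ast}_{m_0}$ in place of $h$. -/

import Mathlib

open MeasureTheory ProbabilityTheory
open scoped ENNReal NNReal

noncomputable section

namespace RandomField

/-- `ℝᵏ` with the Euclidean norm. -/
abbrev Vec (k : ℕ) : Type := EuclideanSpace ℝ (Fin k)

/-- The probability measures on `ℝᵈ × ℝᵈ` with marginals `μ` and `ν`. -/
def couplings {d : ℕ} (μ ν : Measure (Vec d)) : Set (Measure (Vec d × Vec d)) :=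
  {π | IsProbabilityMeasure π ∧ π.map Prod.fst = μ ∧ π.map Prod.snd = ν}

/-- The Wasserstein distance `W₂(μ, ν) = inf_π (E_π ‖y - y'‖²)^(1/2)`. -/
def W2 {d : ℕ} (μ ν : Measure (Vec d)) : ℝ≥0∞ :=
  ⨅ π ∈ couplings μ ν, (∫⁻ z, ‖z.1 - z.2‖ₑ ^ 2 ∂π) ^ (1 / 2 : ℝ)

/-- `W₂²(μ, ν)` as a real number; it is only used for measures with bounded support, for which
`W₂(μ, ν)` is finite. -/
def sqW2 {d : ℕ} (μ ν : Measure (Vec d)) : ℝ := (W2 μ ν).toReal ^ 2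

/-- The law `μ_x` of `y_x = f(x; ω)`, where `ω` has law `P`. -/
def law {n d : ℕ} {Ω : Type*} [MeasurableSpace Ω] (P : Measure Ω) (f : Vec n → Ω → Vec d)
    (x : Vec n) : Measure (Vec d) :=
  P.map (f x)

/-- `(∫ yᵢ⁶ μ(dy))^(1/6)`. -/
def coordMoment {d : ℕ} (μ : Measure (Vec d)) (i : Fin d) : ℝ :=
  (∫ y, (y i) ^ 6 ∂μ) ^ (1 / 6 : ℝ)

/-- The average squared distance `∫_D W₂²(μ_x, μ̂_x) ν(dx)`. -/
def avgSqW2 {n d : ℕ} (D : Set (Vec n)) (ν : Measure (Vec n)) (μ μ' : Vec n → Measure (Vec d)) :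
    ℝ :=
  ∫ x in D, sqW2 (μ x) (μ' x) ∂ν

/-- The uniform probability measure `|s|⁻¹ ∑_{j ∈ s} δ_{z j}` on the points `z j`, `j ∈ s`
(with multiplicity), for nonempty `s`. -/
def empirical {N k : ℕ} (s : Finset (Fin N)) (z : Fin N → Vec k) : Measure (Vec k) :=
  (s.card : ℝ≥0∞)⁻¹ • ∑ j ∈ s, Measure.dirac (z j)

open Classical in
/-- The indices of the sample points in the closed `δ`-ball around `x`. -/
def neighbors {N n : ℕ} (X : Fin N → Vec n) (δ : ℝ) (x : Vec n) : Finset (Fin N) :=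
  {j | ‖X j - x‖ ≤ δ}

/-- `N(x, δ)`: the number of sample points in the closed `δ`-ball around `x`. -/
def nbrCount {N n : ℕ} (X : Fin N → Vec n) (δ : ℝ) (x : Vec n) : ℕ :=
  (neighbors X δ x).card

/-- The empirical measure `νᵉ` of the sample inputs. -/
def inputMeasure {N n : ℕ} (X : Fin N → Vec n) : Measure (Vec n) :=
  empirical Finset.univ X

/-- The local squared `W₂` loss `∫_D W₂²(μᵉ_{x,δ}, μ̂ᵉ_{x,δ}) νᵉ(dx)`, where `μᵉ_{x,δ}` and
`μ̂ᵉ_{x,δ}` are the empirical measures of the outputs `Y j`, resp. `Y' j`, of those samples whose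
input `X j` lies within `δ` of `x`. -/
def localLoss {N n d : ℕ} (D : Set (Vec n)) (δ : ℝ) (X : Fin N → Vec n) (Y Y' : Fin N → Vec d) :
    ℝ :=
  ∫ x in D, sqW2 (empirical (neighbors X δ x) Y) (empirical (neighbors X δ x) Y')
    ∂(inputMeasure X)

/-- The factor `∏ᵢ σᵢ / σ₁`; the coordinates are numbered from `0` here. -/
def heterogeneity {d : ℕ} [NeZero d] (σ : Fin d → ℝ) : ℝ := ∏ i, σ i / σ 0

/-- `2 m^(-1/4) log(1+m)^(1/2)` for `d ≤ 4` and `2 (m^(-1/4) + (r m)^(-1/d))` for `d > 4`. -/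
def rateWith (d : ℕ) (r : ℝ) (m : ℕ) : ℝ :=
  if d ≤ 4 then 2 * (m : ℝ) ^ (-(1 / 4) : ℝ) * Real.log (1 + m) ^ (1 / 2 : ℝ)
  else 2 * ((m : ℝ) ^ (-(1 / 4) : ℝ) + (r * m) ^ (-(1 / d) : ℝ))

/-- The rate function `h(m, d)`: for `d > 4` it is
`2 (m^(-1/4) + (∏ᵢ (σᵢ/σ₁) · m)^(-1/d))`. -/
def rate {d : ℕ} [NeZero d] (σ : Fin d → ℝ) (m : ℕ) : ℝ :=
  rateWith d (heterogeneity σ) m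

/-- The improved rate: from `m ≥ m₀` on, the factor `∏ᵢ (σᵢ/σ₁)` sits in the numerator, so for
`d > 4` it is `2 (m^(-1/4) + (∏ᵢ (σᵢ/σ₁))^(1/d) · m^(-1/d))` when `m ≥ m₀`,
and `h(m, d)` when `m < m₀`. -/
def improvedRate {d : ℕ} [NeZero d] (σ : Fin d → ℝ) (m₀ m : ℕ) : ℝ :=
  if m₀ ≤ m then rateWith d (heterogeneity σ)⁻¹ m else rate σ m

/-- The random pairs `(X i, W i)`, `i = 0, 1, …`, are independent, each with law `ν ⊗ P`:
the inputs are drawn from `ν`, the latent variables from `P`, everything independently. -/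
structure IsIIDSample {Ω E S : Type*} [MeasurableSpace Ω] [MeasurableSpace E] [MeasurableSpace S]
    (Pr : Measure Ω) (ν : Measure E) (P : Measure S) (X : ℕ → Ω → E) (W : ℕ → Ω → S) : Prop where
  hasLaw : ∀ i, HasLaw (fun a => (X i a, W i a)) (ν.prod P) Pr
  indep : iIndepFun (fun i a => (X i a, W i a)) Pr

/-- `|∫_D W₂²(μ_x, μ̂_x) ν(dx) - (local loss)|`, the loss being formed with the first `N` data points
`x_i = X i`, `y_i = f(x_i; W i)`, `ŷ_i = g(x_i; W' i)`. -/
def gap {n d : ℕ} {Ω S S' : Type*} [MeasurableSpace S] [MeasurableSpace S']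
    (D : Set (Vec n)) (ν : Measure (Vec n)) (P : Measure S) (P' : Measure S')
    (f : Vec n → S → Vec d) (g : Vec n → S' → Vec d)
    (X : ℕ → Ω → Vec n) (W : ℕ → Ω → S) (W' : ℕ → Ω → S') (δ : ℝ) (N : ℕ) (a : Ω) : ℝ :=
  |avgSqW2 D ν (law P f) (law P' g) -
    localLoss D δ (fun i : Fin N => X i a) (fun i : Fin N => f (X i a) (W i a))
      (fun i : Fin N => g (X i a) (W' i a))|

/-- `E[h(N(x, δ))]`: the expectation over the first `N` inputs, and over `x` drawn from their
empirical measure `νᵉ`. -/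
def expectedRate {n : ℕ} {Ω : Type*} [MeasurableSpace Ω] (Pr : Measure Ω) (D : Set (Vec n))
    (X : ℕ → Ω → Vec n) (δ : ℝ) (N : ℕ) (h : ℕ → ℝ) : ℝ :=
  ∫ a, (∫ x in D, h (nbrCount (fun i : Fin N => X i a) δ x)
    ∂(inputMeasure fun i : Fin N => X i a)) ∂Pr

end RandomField

end

/-! ### The distance `W2`: triangle inequality, convexity, averages of measures. -/

namespace RandomField

variable {d : ℕ}

/-! Write F(x) = W₂²(μ_x, μ̂_x). The error splits into a Monte Carlo error and an average of local
errors at the sample points. The first compares ∫ F dν with the mean of F over the inputs; since 0 ≤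
F ≤ 4M₀ almost everywhere, its variance is at most (4M₀)²/N, which gives 4M₀/√N
(`IsIIDSample.lintegral_average_sub_integral_le`).

For the local error at x = X i, put A = W₂(μ_x, μ̂_x) and let B be the distance of the two local
empirical measures. Both are at most 2√M₀, so |A² - B²| ≤ 4√M₀ |A - B|, and by the triangle
inequality |A - B| is at most the sum over the two fields of W₂(law at x, empirical measure). Each
of these passes through the average of the laws at the neighbouring inputs: convexity of W₂² bounds
the distance from the law at x to this average by Lδ, and what remains is the fluctuation of an
empirical measure around its mean (`abs_sqW2_sub_sqW2_empirical_le`). Conditionally on the inputs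
the outputs are independent, with laws that vary from point to point; identical distribution is not
needed below.

The fluctuation is estimated by a multiscale transport plan. Space is cut into the dyadic shells of
the sup norm of (yᵢ/σᵢ), and each shell into nested boxes. Mass is matched inside the finest boxes
first; the excess is matched inside boxes one level coarser, and so on, and what is left at the end
is moved between shells (`exists_coupling_le_imbalance`). The mean excess in a box Q is at most
√(μ(Q)/m), and Cauchy–Schwarz over the boxes of a shell brings in the number of boxes. The n-th
shell has mass of order 64⁻ⁿ by the sixth moments, so its contribution 4ⁿ · 8ⁿ⁻²ⁿ = 2⁻ⁿ is summable.
The outcome is E W₂² ≤ S² · const · `scaleSum`, and Jensen's inequality gives E W₂.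

The rates come from choosing the boxes. Isotropic boxes give m^(-1/4) log(1+m)^(1/2) for d ≤ 4 and
m^(-1/d) for d > 4, which is already below h. For the improved rate, the halving of the i-th
coordinate is delayed until the boxes are about as wide as σᵢ. Fewer boxes are then needed at a
given diameter, by the factor ∏ σᵢ/σ₁ up to 2^d, once all coordinates are being halved; the earlier
levels cost O(m^(-1/2)), negligible against m^(-2/d) when d > 4 and m is large (`exists_scales`).

Since W₂ between a law and a random empirical measure enters only through upper bounds, the explicit
and measurable quantity `multiscale` replaces it under the integral sign. -/

theorem W2_le_of_mem_couplings {μ ν : Measure (Vec d)} {π : Measure (Vec d × Vec d)}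
    (hπ : π ∈ couplings μ ν) : W2 μ ν ≤ (∫⁻ z, ‖z.1 - z.2‖ₑ ^ 2 ∂π) ^ (1 / 2 : ℝ) :=
  iInf₂_le π hπ

theorem swap_mem_couplings {μ ν : Measure (Vec d)} {π : Measure (Vec d × Vec d)}
    (hπ : π ∈ couplings μ ν) : π.map Prod.swap ∈ couplings ν μ := by
  obtain ⟨h, h1, h2⟩ := hπ
  refine ⟨Measure.isProbabilityMeasure_map measurable_swap.aemeasurable, ?_, ?_⟩
  · rw [Measure.map_map measurable_fst measurable_swap, ← h2]; rfl
  · rw [Measure.map_map measurable_snd measurable_swap, ← h1]; rfl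

theorem W2_comm_le (μ ν : Measure (Vec d)) : W2 μ ν ≤ W2 ν μ := by
  refine le_iInf₂ fun π hπ => (W2_le_of_mem_couplings (swap_mem_couplings hπ)).trans (le_of_eq ?_)
  rw [lintegral_map (by fun_prop) measurable_swap]
  simp only [Prod.fst_swap, Prod.snd_swap, enorm_sub_rev]

theorem W2_comm (μ ν : Measure (Vec d)) : W2 μ ν = W2 ν μ :=
  le_antisymm (W2_comm_le μ ν) (W2_comm_le ν μ)

/-- The gluing lemma. -/
theorem exists_glue {μ ν ρ : Measure (Vec d)} {π π' : Measure (Vec d × Vec d)}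
    (hπ : π ∈ couplings μ ν) (hπ' : π' ∈ couplings ν ρ) :
    ∃ γ : Measure ((Vec d × Vec d) × Vec d), IsProbabilityMeasure γ ∧ γ.map Prod.fst = π ∧
      γ.map (fun p => (p.1.2, p.2)) = π' := by
  obtain ⟨h, h1, h2⟩ := hπ
  obtain ⟨h', h1', h2'⟩ := hπ'
  have hκ : ν ⊗ₘ π'.condKernel = π' := by
    have := π'.disintegrate π'.condKernel
    rwa [Measure.fst, h1'] at this
  have hν : IsProbabilityMeasure ν := by
    rw [← h2]; exact Measure.isProbabilityMeasure_map measurable_snd.aemeasurable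
  -- The third coordinate is drawn from the conditional law of `π'` given its first coordinate,
  -- evaluated at the second coordinate of `π`.
  refine ⟨π ⊗ₘ (π'.condKernel.comap Prod.snd measurable_snd), inferInstance, ?_, ?_⟩
  · exact Measure.fst_compProd _ _
  · ext s hs
    conv_rhs => rw [← hκ]
    rw [Measure.map_apply (by fun_prop) hs, Measure.compProd_apply hs,
      Measure.compProd_apply (by exact (by fun_prop : Measurable
        (fun p : (Vec d × Vec d) × Vec d => (p.1.2, p.2))) hs), ← h2,
      lintegral_map (Kernel.measurable_kernel_prodMk_left hs) measurable_snd]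
    rfl

/-- Any coupling of μ, ν and any coupling of ν, ρ glue to a measure on triples; Minkowski's
inequality in L² of that measure bounds the cost of its outer marginal. -/
theorem W2_triangle (μ ν ρ : Measure (Vec d)) : W2 μ ρ ≤ W2 μ ν + W2 ν ρ := by
  refine ENNReal.le_iInf₂_add_iInf₂ fun π hπ π' hπ' => ?_
  obtain ⟨γ, hγ, h1, h2⟩ := exists_glue hπ hπ'
  have hmem : γ.map (fun p => (p.1.1, p.2)) ∈ couplings μ ρ := by
    refine ⟨Measure.isProbabilityMeasure_map (by fun_prop), ?_, ?_⟩
    · rw [Measure.map_map (by fun_prop) (by fun_prop), ← hπ.2.1, ← h1,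
        Measure.map_map (by fun_prop) (by fun_prop)]; rfl
    · rw [Measure.map_map (by fun_prop) (by fun_prop), ← hπ'.2.2, ← h2,
        Measure.map_map (by fun_prop) (by fun_prop)]; rfl
  refine (W2_le_of_mem_couplings hmem).trans ?_
  rw [← h1, ← h2, lintegral_map (by fun_prop) (by fun_prop),
    lintegral_map (by fun_prop) (by fun_prop), lintegral_map (by fun_prop) (by fun_prop)]
  have key := ENNReal.lintegral_Lp_add_le (μ := γ) (p := 2)
    (f := fun p => ‖p.1.1 - p.1.2‖ₑ) (g := fun p => ‖p.1.2 - p.2‖ₑ) (by fun_prop) (by fun_prop)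
    (by norm_num)
  simp only [ENNReal.rpow_two] at key
  refine le_trans (ENNReal.rpow_le_rpow (lintegral_mono fun p => ?_) (by norm_num)) key
  simp only [Pi.add_apply]
  gcongr
  simpa using enorm_add_le (p.1.1 - p.1.2) (p.1.2 - p.2)

theorem W2_le_of_lintegral_le {μ ν : Measure (Vec d)} {π : Measure (Vec d × Vec d)}
    (hπ : π ∈ couplings μ ν) {c : ℝ≥0∞} (h : ∫⁻ z, ‖z.1 - z.2‖ₑ ^ 2 ∂π ≤ c ^ 2) :
    W2 μ ν ≤ c := by
  refine (W2_le_of_mem_couplings hπ).trans ?_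
  calc _ ≤ (c ^ 2) ^ (1 / 2 : ℝ) := ENNReal.rpow_le_rpow h (by norm_num)
    _ = c := by rw [← ENNReal.rpow_two, ← ENNReal.rpow_mul]; norm_num

theorem exists_mem_couplings_of_W2_lt {μ ν : Measure (Vec d)} {c : ℝ≥0∞} (h : W2 μ ν < c) :
    ∃ π ∈ couplings μ ν, ∫⁻ z, ‖z.1 - z.2‖ₑ ^ 2 ∂π ≤ c ^ 2 := by
  obtain ⟨π, hπ, hlt⟩ : ∃ π ∈ couplings μ ν,
      (∫⁻ z, ‖z.1 - z.2‖ₑ ^ 2 ∂π) ^ (1 / 2 : ℝ) < c := by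
    simpa [W2, iInf_lt_iff] using h
  refine ⟨π, hπ, ?_⟩
  have := ENNReal.rpow_le_rpow hlt.le (z := 2) (by norm_num)
  rwa [← ENNReal.rpow_mul, ENNReal.rpow_two, show (1 / 2 : ℝ) * 2 = 1 by norm_num,
    ENNReal.rpow_one] at this

theorem prod_mem_couplings (μ ν : Measure (Vec d)) [IsProbabilityMeasure μ]
    [IsProbabilityMeasure ν] : μ.prod ν ∈ couplings μ ν :=
  ⟨inferInstance, by simp, by simp⟩

/-- The product coupling suffices. Besides the bound itself, this supplies the finiteness that makes
the passage to real-valued distances faithful. -/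
theorem W2_le_of_ae_norm_le {μ ν : Measure (Vec d)} [IsProbabilityMeasure μ]
    [IsProbabilityMeasure ν] {M : ℝ} (hμ : ∀ᵐ y ∂μ, ‖y‖ ^ 2 ≤ M) (hν : ∀ᵐ y ∂ν, ‖y‖ ^ 2 ≤ M) :
    W2 μ ν ≤ ENNReal.ofReal (2 * √M) := by
  refine W2_le_of_lintegral_le (prod_mem_couplings μ ν) ?_
  have h1 : ∀ᵐ z ∂μ.prod ν, ‖z.1‖ ^ 2 ≤ M := Measure.quasiMeasurePreserving_fst.ae hμ
  have h2 : ∀ᵐ z ∂μ.prod ν, ‖z.2‖ ^ 2 ≤ M := Measure.quasiMeasurePreserving_snd.ae hν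
  calc ∫⁻ z, ‖z.1 - z.2‖ₑ ^ 2 ∂(μ.prod ν)
      ≤ ∫⁻ _, ENNReal.ofReal (2 * √M) ^ 2 ∂(μ.prod ν) := by
        refine lintegral_mono_ae ?_
        filter_upwards [h1, h2] with z hz1 hz2
        gcongr
        rw [← ofReal_norm]
        refine ENNReal.ofReal_le_ofReal ?_
        have := norm_sub_le z.1 z.2
        have := Real.le_sqrt_of_sq_le hz1
        have := Real.le_sqrt_of_sq_le hz2
        linarith
    _ = _ := by simp

/-- The average of the measures `μ j`, `j ∈ s`. -/
noncomputable def avg {N : ℕ} (s : Finset (Fin N)) {E : Type*} [MeasurableSpace E]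
    (μ : Fin N → Measure E) : Measure E :=
  (s.card : ℝ≥0∞)⁻¹ • ∑ j ∈ s, μ j

theorem empirical_eq_avg {N k : ℕ} (s : Finset (Fin N)) (z : Fin N → Vec k) :
    empirical s z = avg s fun j => Measure.dirac (z j) := rfl

theorem map_finset_sum {ι E F : Type*} [MeasurableSpace E] [MeasurableSpace F] (s : Finset ι)
    (μ : ι → Measure E) {f : E → F} (hf : Measurable f) :
    (∑ j ∈ s, μ j).map f = ∑ j ∈ s, (μ j).map f := by
  ext t ht
  simp [Measure.map_apply hf ht]

theorem avg_map {N : ℕ} (s : Finset (Fin N)) {E F : Type*} [MeasurableSpace E]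
    [MeasurableSpace F] (μ : Fin N → Measure E) {f : E → F} (hf : Measurable f) :
    (avg s μ).map f = avg s fun j => (μ j).map f := by
  rw [avg, avg, Measure.map_smul, map_finset_sum s μ hf]

theorem avg_apply {N : ℕ} (s : Finset (Fin N)) {E : Type*} [MeasurableSpace E]
    (μ : Fin N → Measure E) (t : Set E) :
    avg s μ t = (s.card : ℝ≥0∞)⁻¹ * ∑ j ∈ s, μ j t := by
  simp [avg]

theorem lintegral_avg {N : ℕ} (s : Finset (Fin N)) {E : Type*} [MeasurableSpace E]
    (μ : Fin N → Measure E) (f : E → ℝ≥0∞) :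
    ∫⁻ x, f x ∂(avg s μ) = (s.card : ℝ≥0∞)⁻¹ * ∑ j ∈ s, ∫⁻ x, f x ∂(μ j) := by
  simp [avg]

theorem inv_card_mul_sum_le {N : ℕ} {s : Finset (Fin N)} {a : Fin N → ℝ≥0∞}
    {c : ℝ≥0∞} (h : ∀ j ∈ s, a j ≤ c) : (s.card : ℝ≥0∞)⁻¹ * ∑ j ∈ s, a j ≤ c := by
  rcases s.eq_empty_or_nonempty with rfl | hs
  · simp
  have h0 : (s.card : ℝ≥0∞) ≠ 0 := by simpa using hs.ne_empty
  calc (s.card : ℝ≥0∞)⁻¹ * ∑ j ∈ s, a j ≤ (s.card : ℝ≥0∞)⁻¹ * ∑ j ∈ s, c := by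
        gcongr with j hj; exact h j hj
    _ = c := by
        rw [Finset.sum_const, nsmul_eq_mul, ← mul_assoc, ENNReal.inv_mul_cancel h0 (by simp),
          one_mul]

theorem avg_const {N : ℕ} {s : Finset (Fin N)} (hs : s.Nonempty) {E : Type*} [MeasurableSpace E]
    (μ : Measure E) : avg s (fun _ => μ) = μ := by
  have h0 : (s.card : ℝ≥0∞) ≠ 0 := by simpa using hs.ne_empty
  ext t ht
  rw [avg_apply, Finset.sum_const, nsmul_eq_mul, ← mul_assoc,
    ENNReal.inv_mul_cancel h0 (by simp), one_mul]

theorem isProbabilityMeasure_avg {N : ℕ} {s : Finset (Fin N)} (hs : s.Nonempty) {E : Type*}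
    [MeasurableSpace E] (μ : Fin N → Measure E) (h : ∀ j ∈ s, IsProbabilityMeasure (μ j)) :
    IsProbabilityMeasure (avg s μ) := by
  have h0 : (s.card : ℝ≥0∞) ≠ 0 := by simpa using hs.ne_empty
  refine ⟨?_⟩
  rw [avg_apply, Finset.sum_congr rfl fun j hj => (h j hj).measure_univ, Finset.sum_const,
    nsmul_eq_mul, mul_one, ENNReal.inv_mul_cancel h0 (by simp)]

/-- Joint convexity of `W₂²`, for couplings. -/
theorem avg_mem_couplings {N : ℕ} {s : Finset (Fin N)} (hs : s.Nonempty)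
    {μ ν : Fin N → Measure (Vec d)} {π : Fin N → Measure (Vec d × Vec d)}
    (h : ∀ j ∈ s, π j ∈ couplings (μ j) (ν j)) : avg s π ∈ couplings (avg s μ) (avg s ν) := by
  refine ⟨isProbabilityMeasure_avg hs π fun j hj => (h j hj).1, ?_, ?_⟩
  · rw [avg_map s π measurable_fst, avg, avg, Finset.sum_congr rfl fun j hj => (h j hj).2.1]
  · rw [avg_map s π measurable_snd, avg, avg, Finset.sum_congr rfl fun j hj => (h j hj).2.2]

/-- The average of near-optimal couplings couples the averages, and its quadratic cost is the
average of the costs. The slack `ε` is there because the infimum in `W2` is not shown to be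
attained. -/
theorem W2_avg_le {N : ℕ} {s : Finset (Fin N)} (hs : s.Nonempty) {μ ν : Fin N → Measure (Vec d)}
    {c : ℝ≥0} (h : ∀ j ∈ s, W2 (μ j) (ν j) ≤ c) : W2 (avg s μ) (avg s ν) ≤ c := by
  refine ENNReal.le_of_forall_pos_le_add fun ε hε _ => ?_
  have hlt : ∀ j ∈ s, W2 (μ j) (ν j) < (c + ε : ℝ≥0) := fun j hj =>
    (h j hj).trans_lt (by exact_mod_cast lt_add_of_pos_right c hε)
  choose! π hπ hle using fun j hj => exists_mem_couplings_of_W2_lt (hlt j hj)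
  refine (W2_le_of_lintegral_le (avg_mem_couplings hs hπ) ?_).trans_eq (ENNReal.coe_add c ε)
  rw [lintegral_avg]
  exact inv_card_mul_sum_le hle

/-- Points with the same index are coupled. This makes `W2` of empirical measures continuous in the
points. -/
theorem W2_empirical_le {N : ℕ} {s : Finset (Fin N)} (hs : s.Nonempty) {y z : Fin N → Vec d}
    {c : ℝ≥0∞} (h : ∀ j ∈ s, ‖y j - z j‖ₑ ≤ c) : W2 (empirical s y) (empirical s z) ≤ c := by
  have hm := avg_mem_couplings hs (μ := fun j => Measure.dirac (y j))
    (ν := fun j => Measure.dirac (z j)) (π := fun j => Measure.dirac (y j, z j))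
    (fun j _ => ⟨inferInstance, by simp [Measure.map_dirac], by simp [Measure.map_dirac]⟩)
  refine W2_le_of_lintegral_le hm ?_
  rw [lintegral_avg]
  refine inv_card_mul_sum_le fun j hj => ?_
  rw [lintegral_dirac]
  gcongr
  exact h j hj

end RandomField

/-! ### Multiscale matching of two measures along nested partitions. -/

namespace RandomField

section Matching

variable {E ι : Type*} [MeasurableSpace E] [MeasurableSpace ι] [MeasurableSingletonClass ι]

theorem sum_smul_restrict_fiber_apply (μ : Measure E) {c : E → ι} (hc : Measurable c)
    (b : ι → ℝ≥0∞) (j : ι) :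
    Measure.sum (fun i => b i • μ.restrict (c ⁻¹' {i})) (c ⁻¹' {j}) = b j * μ (c ⁻¹' {j}) := by
  have hm : ∀ i, MeasurableSet (c ⁻¹' {i}) := fun i => hc (measurableSet_singleton i)
  rw [Measure.sum_apply _ (hm j), tsum_eq_single j]
  · simp [Measure.restrict_apply (hm j)]
  · intro i hi
    have : c ⁻¹' {j} ∩ c ⁻¹' {i} = ∅ := by
      ext x; simp only [Set.mem_inter_iff, Set.mem_preimage, Set.mem_singleton_iff,
        Set.mem_empty_iff_false, iff_false, not_and]
      rintro rfl; exact fun h => hi h.symm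
    simp [Measure.restrict_apply (hm j), this]

theorem map_fst_fiber_eq_map_snd_fiber {π : Measure (E × E)} {c : E → ι} (hc : Measurable c)
    (h : ∀ᵐ z ∂π, c z.1 = c z.2) (i : ι) :
    π.map Prod.fst (c ⁻¹' {i}) = π.map Prod.snd (c ⁻¹' {i}) := by
  rw [Measure.map_apply measurable_fst (hc (measurableSet_singleton i)),
    Measure.map_apply measurable_snd (hc (measurableSet_singleton i))]
  refine measure_congr ?_
  filter_upwards [h] with z hz
  change (c z.1 = i) = (c z.2 = i)
  rw [hz]

variable [Countable ι]

theorem sum_restrict_fiber (μ : Measure E) {c : E → ι} (hc : Measurable c) :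
    Measure.sum (fun i => μ.restrict (c ⁻¹' {i})) = μ := by
  have hm : ∀ i, MeasurableSet (c ⁻¹' {i}) := fun i => hc (measurableSet_singleton i)
  rw [← Measure.restrict_iUnion _ hm]
  · have : ⋃ i, c ⁻¹' {i} = Set.univ := by ext x; simp
    rw [this, Measure.restrict_univ]
  · intro i j hij
    refine Set.disjoint_left.2 fun x hx hx' => hij ?_
    simp only [Set.mem_preimage, Set.mem_singleton_iff] at hx hx'
    rw [← hx, hx']

theorem eq_sum_smul_add_sum_smul (μ : Measure E) {c : E → ι} (hc : Measurable c)
    {a : ι → ℝ≥0∞} (ha : ∀ i, a i ≤ 1) :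
    μ = Measure.sum (fun i => a i • μ.restrict (c ⁻¹' {i})) +
      Measure.sum (fun i => (1 - a i) • μ.restrict (c ⁻¹' {i})) := by
  rw [Measure.sum_add_sum]
  conv_lhs => rw [← sum_restrict_fiber μ hc]
  congr 1
  ext1 i
  rw [← add_smul, add_tsub_cancel_of_le (ha i), one_smul]

/-- For a cell of masses m and n, the product coupling divided by max m n matches the mass min m n;
what is left of m is the truncated difference m - n. -/
theorem one_sub_inv_max_mul {m n : ℝ≥0∞} (hm : m ≠ ∞) (hn : n ≠ ∞) :
    (1 - (max m n)⁻¹ * n) * m = m - n := by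
  rcases le_total m n with h | h
  · rcases eq_or_ne n 0 with rfl | h0
    · simp
    · rw [max_eq_right h, ENNReal.inv_mul_cancel h0 hn, tsub_self, zero_mul, tsub_eq_zero_of_le h]
  · rcases eq_or_ne m 0 with rfl | h0
    · simp
    · rw [max_eq_left h, ENNReal.sub_mul fun _ _ => hm, one_mul, mul_comm m⁻¹, mul_assoc,
        ENNReal.inv_mul_cancel h0 hm, mul_one]

theorem inv_max_mul_le_one (m n : ℝ≥0∞) : (max m n)⁻¹ * n ≤ 1 :=
  calc (max m n)⁻¹ * n ≤ (max m n)⁻¹ * max m n := by gcongr; exact le_max_right _ _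
    _ ≤ 1 := ENNReal.inv_mul_le_one _

/-- As much mass of `μ` and `ν` as possible is matched inside the cells of the partition by the
fibres of `c`. -/
theorem exists_match (μ ν : Measure E) [IsFiniteMeasure μ] [IsFiniteMeasure ν] {c : E → ι}
    (hc : Measurable c) :
    ∃ (π : Measure (E × E)) (μ' ν' : Measure E),
      μ = π.map Prod.fst + μ' ∧ ν = π.map Prod.snd + ν' ∧ (∀ᵐ z ∂π, c z.1 = c z.2) ∧
      (∀ i, μ' (c ⁻¹' {i}) = μ (c ⁻¹' {i}) - ν (c ⁻¹' {i})) ∧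
      (∀ i, ν' (c ⁻¹' {i}) = ν (c ⁻¹' {i}) - μ (c ⁻¹' {i})) := by
  have hm : ∀ i, MeasurableSet (c ⁻¹' {i}) := fun i => hc (measurableSet_singleton i)
  -- If both masses vanish then `t i = ∞`, which is harmless because it multiplies the zero measure.
  let t : ι → ℝ≥0∞ := fun i => (max (μ (c ⁻¹' {i})) (ν (c ⁻¹' {i})))⁻¹
  let π : Measure (E × E) := Measure.sum fun i =>
    t i • (μ.restrict (c ⁻¹' {i})).prod (ν.restrict (c ⁻¹' {i}))
  have h1 : π.map Prod.fst =
      Measure.sum fun i => (t i * ν (c ⁻¹' {i})) • μ.restrict (c ⁻¹' {i}) := by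
    rw [Measure.map_sum measurable_fst.aemeasurable]
    congr 1; ext1 i
    rw [Measure.map_smul, Measure.map_fst_prod, smul_smul, Measure.restrict_apply_univ]
  have h2 : π.map Prod.snd =
      Measure.sum fun i => (t i * μ (c ⁻¹' {i})) • ν.restrict (c ⁻¹' {i}) := by
    rw [Measure.map_sum measurable_snd.aemeasurable]
    congr 1; ext1 i
    rw [Measure.map_smul, Measure.map_snd_prod, smul_smul, Measure.restrict_apply_univ]
  have ht : ∀ i, t i * μ (c ⁻¹' {i}) ≤ 1 := fun i => by
    simp only [t, max_comm (μ _)]; exact inv_max_mul_le_one _ _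
  refine ⟨π, Measure.sum (fun i => (1 - t i * ν (c ⁻¹' {i})) • μ.restrict (c ⁻¹' {i})),
    Measure.sum (fun i => (1 - t i * μ (c ⁻¹' {i})) • ν.restrict (c ⁻¹' {i})), ?_, ?_, ?_, ?_, ?_⟩
  · rw [h1]; exact eq_sum_smul_add_sum_smul μ hc fun i => inv_max_mul_le_one _ _
  · rw [h2]; exact eq_sum_smul_add_sum_smul ν hc ht
  · rw [Measure.ae_sum_iff' (measurableSet_eq_fun (by fun_prop) (by fun_prop))]
    intro i
    refine Measure.ae_smul_measure ?_ _
    have e1 : ∀ᵐ z ∂(μ.restrict (c ⁻¹' {i})).prod (ν.restrict (c ⁻¹' {i})), c z.1 = i :=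
      Measure.quasiMeasurePreserving_fst.ae (ae_restrict_mem (hm i))
    have e2 : ∀ᵐ z ∂(μ.restrict (c ⁻¹' {i})).prod (ν.restrict (c ⁻¹' {i})), c z.2 = i :=
      Measure.quasiMeasurePreserving_snd.ae (ae_restrict_mem (hm i))
    filter_upwards [e1, e2] with z h h'
    rw [h, h']
  · intro i
    rw [sum_smul_restrict_fiber_apply μ hc]
    exact one_sub_inv_max_mul (measure_ne_top _ _) (measure_ne_top _ _)
  · intro i
    rw [sum_smul_restrict_fiber_apply ν hc]
    simp only [t, max_comm (μ _)]
    exact one_sub_inv_max_mul (measure_ne_top _ _) (measure_ne_top _ _)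

theorem lintegral_comp_eq_tsum_fiber (μ : Measure E) {c : E → ι} (hc : Measurable c)
    (g : ι → ℝ≥0∞) : ∫⁻ x, g (c x) ∂μ = ∑' i, g i * μ (c ⁻¹' {i}) := by
  have hg : Measurable g := measurable_of_countable g
  rw [← lintegral_map hg hc, lintegral_countable']
  exact tsum_congr fun i => by rw [Measure.map_apply hc (measurableSet_singleton i)]

/-- The excess of mass of `μ` over `ν` in the cells of the partition by the fibres of `c l`,
weighted by the factor `g` of the cell. -/
noncomputable def imbalance (c : ℕ → E → ι) (g : ι → ℝ≥0∞) (l : ℕ) (μ ν : Measure E) : ℝ≥0∞ :=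
  ∑' i, g i * (μ (c l ⁻¹' {i}) - ν (c l ⁻¹' {i}))

/-- Descending induction on the level, from the finest level L. What is left over after level l + 1
is matched inside the cells of level l at unit cost `b l * g`; the mass involved is at most the
excess of μ over ν in the cells of level l + 1, which is the term `imbalance c g (l + 1) μ ν`. The
weight g depends on the shell only, so it is the same at all levels. -/
theorem exists_partial_match (μ ν : Measure E) [IsFiniteMeasure μ] [IsFiniteMeasure ν]
    {c : ℕ → E → ι} (hc : ∀ l, Measurable (c l))
    (href : ∀ l x y, c (l + 1) x = c (l + 1) y → c l x = c l y)
    {g : ι → ℝ≥0∞} (hg : ∀ l x, g (c l x) = g (c 0 x)) {K : E × E → ℝ≥0∞} {b : ℕ → ℝ≥0∞}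
    (hK : ∀ l x y, c l x = c l y → K (x, y) ≤ b l * g (c l x)) (L : ℕ) {l : ℕ} (hl : l ≤ L) :
    ∃ (π : Measure (E × E)) (μ' ν' : Measure E),
      μ = π.map Prod.fst + μ' ∧ ν = π.map Prod.snd + ν' ∧ (∀ᵐ z ∂π, c l z.1 = c l z.2) ∧
      (∀ i, μ' (c l ⁻¹' {i}) = μ (c l ⁻¹' {i}) - ν (c l ⁻¹' {i})) ∧
      (∀ i, ν' (c l ⁻¹' {i}) = ν (c l ⁻¹' {i}) - μ (c l ⁻¹' {i})) ∧
      ∫⁻ z, K z ∂π ≤ b L * ∫⁻ x, g (c 0 x) ∂μ +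
        ∑ k ∈ Finset.Ico l L, b k * imbalance c g (k + 1) μ ν := by
  have hgm : Measurable g := measurable_of_countable g
  have step : ∀ (l : ℕ) (μ₁ : Measure E) (π₁ : Measure (E × E)),
      (∀ᵐ z ∂π₁, c l z.1 = c l z.2) → π₁.map Prod.fst ≤ μ₁ →
      ∫⁻ z, K z ∂π₁ ≤ b l * ∫⁻ x, g (c 0 x) ∂μ₁ := by
    intro l μ₁ π₁ h hle
    calc ∫⁻ z, K z ∂π₁ ≤ ∫⁻ z, b l * g (c 0 z.1) ∂π₁ := by
          refine lintegral_mono_ae ?_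
          filter_upwards [h] with z hz
          rw [← hg l]; exact hK l z.1 z.2 hz
      _ = b l * ∫⁻ x, g (c 0 x) ∂(π₁.map Prod.fst) := by
          have := hc 0
          rw [lintegral_const_mul _ (by fun_prop), lintegral_map (by fun_prop) measurable_fst]
      _ ≤ _ := by gcongr
  induction hl using Nat.decreasingInduction with
  | self =>
    obtain ⟨π, μ', ν', h1, h2, h3, h4, h5⟩ := exists_match μ ν (hc L)
    refine ⟨π, μ', ν', h1, h2, h3, h4, h5, ?_⟩
    simp only [Finset.Ico_self, Finset.sum_empty, add_zero]
    refine step L μ π h3 ?_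
    conv_rhs => rw [h1]
    exact Measure.le_add_right le_rfl
  | of_succ l hl ih =>
    obtain ⟨π, μ', ν', h1, h2, h3, h4, h5, h6⟩ := ih
    have hμ' : IsFiniteMeasure μ' :=
      isFiniteMeasure_of_le μ (by conv_rhs => rw [h1]
                                  exact Measure.le_add_left le_rfl)
    have hν' : IsFiniteMeasure ν' :=
      isFiniteMeasure_of_le ν (by conv_rhs => rw [h2]
                                  exact Measure.le_add_left le_rfl)
    obtain ⟨π₁, μ'', ν'', k1, k2, k3, k4, k5⟩ := exists_match μ' ν' (hc l)
    have h3' : ∀ᵐ z ∂π, c l z.1 = c l z.2 := h3.mono fun z hz => href l _ _ hz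
    have heq := map_fst_fiber_eq_map_snd_fiber (hc l) h3'
    have hfin : ∀ i, π.map Prod.snd (c l ⁻¹' {i}) ≠ ∞ := fun i =>
      ne_top_of_le_ne_top (measure_ne_top ν (c l ⁻¹' {i})) (by
        conv_rhs => rw [h2]
        simp)
    refine ⟨π + π₁, μ'', ν'', ?_, ?_, ?_, ?_, ?_, ?_⟩
    · rw [Measure.map_add _ _ measurable_fst, add_assoc, ← k1, ← h1]
    · rw [Measure.map_add _ _ measurable_snd, add_assoc, ← k2, ← h2]
    · exact ae_add_measure_iff.2 ⟨h3', k3⟩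
    -- By refinement, the mass matched so far also stays inside the cells of level l, so it takes
    -- equal amounts from μ and ν there and cancels in the difference.
    · intro i
      rw [k4 i, h1, h2]
      simp only [Measure.add_apply]
      rw [heq i, ENNReal.add_sub_add_eq_sub_left (hfin i)]
    · intro i
      rw [k5 i, h1, h2]
      simp only [Measure.add_apply]
      rw [heq i, ENNReal.add_sub_add_eq_sub_left (hfin i)]
    · rw [lintegral_add_measure, Finset.sum_eq_sum_Ico_succ_bot hl, add_comm (b l * _), ← add_assoc]
      refine add_le_add h6 ((step l μ' π₁ k3 ?_).trans_eq ?_)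
      · conv_rhs => rw [k1]
        exact Measure.le_add_right le_rfl
      · congr 1
        simp only [← hg (l + 1)]
        rw [lintegral_comp_eq_tsum_fiber μ' (hc (l + 1)) g]
        simp only [h4]
        rfl

/-- The multiscale bound for the transport cost of two probability measures. -/
theorem exists_coupling_le_imbalance (μ ν : Measure E) [IsProbabilityMeasure μ]
    [IsProbabilityMeasure ν]
    {c : ℕ → E → ι} (hc : ∀ l, Measurable (c l))
    (href : ∀ l x y, c (l + 1) x = c (l + 1) y → c l x = c l y)
    {g : ι → ℝ≥0∞} (hg : ∀ l x, g (c l x) = g (c 0 x)) {K : E × E → ℝ≥0∞} {b : ℕ → ℝ≥0∞}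
    (hK : ∀ l x y, c l x = c l y → K (x, y) ≤ b l * g (c l x)) {b' : ℝ≥0∞}
    (hK' : ∀ x y, K (x, y) ≤ b' * (g (c 0 x) + g (c 0 y))) (L : ℕ) :
    ∃ π : Measure (E × E), IsProbabilityMeasure π ∧ π.map Prod.fst = μ ∧ π.map Prod.snd = ν ∧
      ∫⁻ z, K z ∂π ≤ b L * ∫⁻ x, g (c 0 x) ∂μ +
        ∑ k ∈ Finset.range L, b k * imbalance c g (k + 1) μ ν +
        b' * (imbalance c g 0 μ ν + imbalance c g 0 ν μ) := by
  have hgm : Measurable g := measurable_of_countable g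
  have hc0 := hc 0
  obtain ⟨π, μ', ν', h1, h2, h3, h4, h5, h6⟩ :=
    exists_partial_match μ ν hc href hg hK L (Nat.zero_le L)
  have hμ' : IsFiniteMeasure μ' :=
    isFiniteMeasure_of_le μ (by conv_rhs => rw [h1]
                                exact Measure.le_add_left le_rfl)
  have hν' : IsFiniteMeasure ν' :=
    isFiniteMeasure_of_le ν (by conv_rhs => rw [h2]
                                exact Measure.le_add_left le_rfl)
  have e1 : π Set.univ + μ' Set.univ = 1 := by
    rw [← measure_univ (μ := μ)]
    conv_rhs => rw [h1]
    simp [Measure.map_apply measurable_fst]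
  have e2 : π Set.univ + ν' Set.univ = 1 := by
    rw [← measure_univ (μ := ν)]
    conv_rhs => rw [h2]
    simp [Measure.map_apply measurable_snd]
  have hπtop : π Set.univ ≠ ∞ := ne_top_of_le_ne_top ENNReal.one_ne_top (e1 ▸ le_self_add)
  have emass : μ' Set.univ = ν' Set.univ := (ENNReal.add_right_inj hπtop).1 (e1.trans e2.symm)
  set t := μ' Set.univ with ht
  have httop : t ≠ ∞ := measure_ne_top _ _
  have hinv : t⁻¹ * t ≤ 1 := ENNReal.inv_mul_le_one _
  -- The leftovers have equal mass t and are joined by their product divided by t. If t = 0 then t⁻¹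
  -- = ∞, but the leftovers vanish.
  have hone : ∀ ρ : Measure E, ρ Set.univ = t → (t⁻¹ * t) • ρ = ρ := by
    intro ρ hρ
    rcases eq_or_ne t 0 with h0 | h0
    · rw [h0, Measure.measure_univ_eq_zero] at hρ
      simp [hρ]
    · rw [ENNReal.inv_mul_cancel h0 httop, one_smul]
  have f1 : (π + t⁻¹ • μ'.prod ν').map Prod.fst = μ := by
    rw [Measure.map_add _ _ measurable_fst, Measure.map_smul, Measure.map_fst_prod, ← emass,
      smul_smul, hone μ' rfl, ← h1]
  have f2 : (π + t⁻¹ • μ'.prod ν').map Prod.snd = ν := by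
    rw [Measure.map_add _ _ measurable_snd, Measure.map_smul, Measure.map_snd_prod,
      smul_smul, hone ν' emass.symm, ← h2]
  refine ⟨π + t⁻¹ • μ'.prod ν', ⟨?_⟩, f1, f2, ?_⟩
  · rw [← measure_univ (μ := μ), ← f1, Measure.map_apply measurable_fst MeasurableSet.univ,
      Set.preimage_univ]
  · rw [lintegral_add_measure, lintegral_smul_measure, smul_eq_mul]
    refine add_le_add (by simpa using h6) ?_
    have g1 : ∫⁻ x, g (c 0 x) ∂μ' = imbalance c g 0 μ ν := by
      rw [lintegral_comp_eq_tsum_fiber μ' (hc 0) g]; simp only [h4]; rfl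
    have g2 : ∫⁻ x, g (c 0 x) ∂ν' = imbalance c g 0 ν μ := by
      rw [lintegral_comp_eq_tsum_fiber ν' (hc 0) g]; simp only [h5]; rfl
    calc t⁻¹ * ∫⁻ z, K z ∂(μ'.prod ν')
        ≤ t⁻¹ * ∫⁻ z, b' * (g (c 0 z.1) + g (c 0 z.2)) ∂(μ'.prod ν') := by
          gcongr with z; exact hK' z.1 z.2
      _ = t⁻¹ * (b' * (∫⁻ x, g (c 0 x) ∂((μ'.prod ν').map Prod.fst) +
            ∫⁻ x, g (c 0 x) ∂((μ'.prod ν').map Prod.snd))) := by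
          rw [lintegral_const_mul _ (by fun_prop), lintegral_add_left (by fun_prop),
            lintegral_map (by fun_prop) measurable_fst, lintegral_map (by fun_prop) measurable_snd]
      _ = (t⁻¹ * t) * (b' * (imbalance c g 0 μ ν + imbalance c g 0 ν μ)) := by
          rw [Measure.map_fst_prod, Measure.map_snd_prod, lintegral_smul_measure,
            lintegral_smul_measure, ← emass, ← ht, g1, g2, smul_eq_mul, smul_eq_mul]
          ring
      _ ≤ _ := mul_le_of_le_one_left' hinv

end Matching

end RandomField

/-! ### Dyadic shells and anisotropic dyadic cells. -/

namespace RandomField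

section Cells

variable {d : ℕ}

/-- The sup norm of `(yᵢ / σᵢ)ᵢ`. -/
noncomputable def scaledNorm (σ : Fin d → ℝ) (y : Vec d) : ℝ := ‖fun i => y i / σ i‖

/-- The least `n` with `|yᵢ| ≤ 2ⁿ σᵢ` for all `i`. -/
noncomputable def shell (σ : Fin d → ℝ) (y : Vec d) : ℕ := Nat.clog 2 ⌈scaledNorm σ y⌉₊

/-- The dyadic cell of level `l` containing `y`. The `n`-th shell is cut along the `i`-th coordinate
into intervals of length `2ⁿ σᵢ / 2^(l - aᵢ)`, so the halving starts at level `aᵢ`. -/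
noncomputable def cell (σ : Fin d → ℝ) (a : Fin d → ℕ) (l : ℕ) (y : Vec d) : ℕ × (Fin d → ℤ) :=
  (shell σ y, fun i => ⌊2 ^ (l - a i) * (y i / (σ i * 2 ^ shell σ y))⌋)

theorem measurable_shell (σ : Fin d → ℝ) : Measurable (shell σ) := by
  have h : Measurable (scaledNorm σ) := by
    unfold scaledNorm
    refine Measurable.norm (measurable_pi_lambda _ fun i => ?_)
    fun_prop
  exact (measurable_of_countable (Nat.clog 2)).comp (Nat.measurable_ceil.comp h)

theorem measurable_cell (σ : Fin d → ℝ) (a : Fin d → ℕ) (l : ℕ) : Measurable (cell σ a l) := by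
  have h := measurable_shell σ
  have h2 : Measurable fun y => (2 : ℝ) ^ shell σ y :=
    (measurable_of_countable fun n : ℕ => (2 : ℝ) ^ n).comp h
  refine h.prodMk (measurable_pi_lambda _ fun i => Int.measurable_floor.comp ?_)
  fun_prop

theorem cell_eq_of_cell_succ_eq (σ : Fin d → ℝ) (a : Fin d → ℕ) (l : ℕ) (x y : Vec d)
    (h : cell σ a (l + 1) x = cell σ a (l + 1) y) : cell σ a l x = cell σ a l y := by
  simp only [cell, Prod.mk.injEq] at h ⊢
  refine ⟨h.1, funext fun i => ?_⟩
  have hi := congrFun h.2 i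
  rcases le_or_gt (l + 1) (a i) with hl | hl
  · rw [Nat.sub_eq_zero_of_le hl] at hi
    rw [Nat.sub_eq_zero_of_le (by omega : l ≤ a i)]
    exact hi
  · have e : l + 1 - a i = (l - a i) + 1 := by omega
    -- Halving an interval is integer division of its index by 2; before level `a i` nothing is
    -- halved and the index stays the same.
    have key : ∀ t : ℝ, ⌊(2 : ℝ) ^ (l - a i) * t⌋ = ⌊(2 : ℝ) ^ (l + 1 - a i) * t⌋ / 2 := by
      intro t
      have := Int.floor_div_natCast ((2 : ℝ) ^ (l + 1 - a i) * t) 2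
      rw [Nat.cast_ofNat, Nat.cast_ofNat] at this
      rw [← this, e, pow_succ]
      congr 1; ring
    rw [key, key, hi]

theorem scaledNorm_le_two_pow_shell (σ : Fin d → ℝ) (y : Vec d) :
    scaledNorm σ y ≤ 2 ^ shell σ y := by
  have h := Nat.le_pow_clog (b := 2) (by norm_num) ⌈scaledNorm σ y⌉₊
  have := Nat.ceil_le.1 h
  exact_mod_cast this

theorem two_pow_lt_scaledNorm {σ : Fin d → ℝ} {y : Vec d} {n : ℕ} (h : shell σ y = n + 1) :
    2 ^ n < scaledNorm σ y := by
  by_contra! hle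
  have h1 : ⌈scaledNorm σ y⌉₊ ≤ 2 ^ n := Nat.ceil_le.2 (by exact_mod_cast hle)
  have := Nat.clog_le_of_le_pow h1
  rw [shell] at h
  omega

theorem abs_coord_le {σ : Fin d → ℝ} (hσ : ∀ i, 0 < σ i) (y : Vec d) (i : Fin d) :
    |y i| ≤ σ i * 2 ^ shell σ y := by
  have h := (norm_le_pi_norm (fun i => y i / σ i) i).trans (scaledNorm_le_two_pow_shell σ y)
  rw [Real.norm_eq_abs, abs_div, abs_of_pos (hσ i), div_le_iff₀ (hσ i)] at h
  linarith

theorem enorm_sq_le_of_abs_coord_le {y : Vec d} {r : ℝ} (h : ∀ i, |y i| ≤ r) :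
    ‖y‖ₑ ^ 2 ≤ ENNReal.ofReal (d * r ^ 2) := by
  rw [← ofReal_norm, ← ENNReal.ofReal_pow (norm_nonneg y)]
  refine ENNReal.ofReal_le_ofReal ?_
  rw [EuclideanSpace.norm_sq_eq]
  calc ∑ i, ‖y i‖ ^ 2 ≤ ∑ _i : Fin d, r ^ 2 :=
        Finset.sum_le_sum fun i _ => by
          rw [Real.norm_eq_abs]; exact pow_le_pow_left₀ (abs_nonneg _) (h i) 2
    _ = d * r ^ 2 := by simp

theorem ofReal_mul_four_pow {x : ℝ} (hx : 0 ≤ x) (n : ℕ) :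
    ENNReal.ofReal (x * 4 ^ n) = ENNReal.ofReal x * 4 ^ n := by
  rw [ENNReal.ofReal_mul hx, ENNReal.ofReal_pow (by norm_num)]
  norm_num

/-- The i-th side is σᵢ 2ⁿ / 2^(l - aᵢ) ≤ (σᵢ 2^aᵢ) 2ⁿ / 2^l ≤ S 2ⁿ / 2^l. Truncation of l - aᵢ at 0
goes in the right direction, so a delay is free as long as σᵢ 2^aᵢ ≤ S. -/
theorem enorm_sub_sq_le_of_cell_eq {σ : Fin d → ℝ} (hσ : ∀ i, 0 < σ i) {a : Fin d → ℕ} {S : ℝ}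
    (ha : ∀ i, σ i * 2 ^ a i ≤ S) (l : ℕ) (x y : Vec d) (h : cell σ a l x = cell σ a l y) :
    ‖x - y‖ₑ ^ 2 ≤ ENNReal.ofReal (d * S ^ 2 / 4 ^ l) * 4 ^ (cell σ a l x).1 := by
  have hn : shell σ x = shell σ y := congrArg Prod.fst h
  have h4 : ∀ n : ℕ, (4 : ℝ) ^ n = (2 ^ n) ^ 2 := fun n => by
    rw [← pow_mul, mul_comm, pow_mul]; norm_num
  have key : ∀ i, |(x - y) i| ≤ S * 2 ^ shell σ x / 2 ^ l := by
    intro i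
    have hfl : ⌊2 ^ (l - a i) * (x i / (σ i * 2 ^ shell σ x))⌋ =
        ⌊2 ^ (l - a i) * (y i / (σ i * 2 ^ shell σ x))⌋ := by
      have := congrFun (congrArg Prod.snd h) i
      simp only [cell] at this
      rwa [← hn] at this
    have h1 := Int.abs_sub_lt_one_of_floor_eq_floor hfl
    have hp : 0 < σ i * 2 ^ shell σ x := mul_pos (hσ i) (by positivity)
    have hq : (0 : ℝ) < 2 ^ (l - a i) := by positivity
    have e : 2 ^ (l - a i) * (x i / (σ i * 2 ^ shell σ x)) -
        2 ^ (l - a i) * (y i / (σ i * 2 ^ shell σ x)) =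
        2 ^ (l - a i) * (x i - y i) / (σ i * 2 ^ shell σ x) := by ring
    rw [e, abs_div, abs_mul, abs_of_pos hp, abs_of_pos hq, div_lt_one hp] at h1
    have hl : (2 : ℝ) ^ l ≤ 2 ^ (l - a i) * 2 ^ a i := by
      rw [← pow_add]; exact pow_le_pow_right₀ (by norm_num) (by omega)
    rw [le_div_iff₀ (by positivity), PiLp.sub_apply]
    calc |x i - y i| * 2 ^ l ≤ |x i - y i| * (2 ^ (l - a i) * 2 ^ a i) := by gcongr
      _ = (2 ^ (l - a i) * |x i - y i|) * 2 ^ a i := by ring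
      _ ≤ (σ i * 2 ^ shell σ x) * 2 ^ a i := by gcongr
      _ = (σ i * 2 ^ a i) * 2 ^ shell σ x := by ring
      _ ≤ S * 2 ^ shell σ x := by gcongr; exact ha i
  refine (enorm_sq_le_of_abs_coord_le key).trans_eq ?_
  rw [← ofReal_mul_four_pow (by positivity)]
  congr 1
  simp only [cell, h4]
  ring

/-- This is the cost of the mass still unmatched at level 0, which has to move between different
shells. -/
theorem enorm_sub_sq_le_shell {σ : Fin d → ℝ} (hσ : ∀ i, 0 < σ i) {S : ℝ}
    (hS : ∀ i, σ i ≤ S) (x y : Vec d) :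
    ‖x - y‖ₑ ^ 2 ≤ ENNReal.ofReal (2 * d * S ^ 2) * (4 ^ shell σ x + 4 ^ shell σ y) := by
  have h4 : ∀ n : ℕ, (4 : ℝ) ^ n = (2 ^ n) ^ 2 := fun n => by
    rw [← pow_mul, mul_comm, pow_mul]; norm_num
  have key : ∀ z : Vec d, ‖z‖ₑ ^ 2 ≤ ENNReal.ofReal (d * S ^ 2) * 4 ^ shell σ z := by
    intro z
    have : ∀ i, |z i| ≤ S * 2 ^ shell σ z := fun i => (abs_coord_le hσ z i).trans (by
      gcongr; exact hS i)
    refine (enorm_sq_le_of_abs_coord_le this).trans_eq ?_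
    rw [← ofReal_mul_four_pow (by positivity), h4]
    congr 1; ring
  calc ‖x - y‖ₑ ^ 2 ≤ (‖x‖ₑ + ‖y‖ₑ) ^ 2 := by gcongr; exact enorm_sub_le
    _ ≤ 2 * (‖x‖ₑ ^ 2 + ‖y‖ₑ ^ 2) := by
        have := ENNReal.rpow_add_le_mul_rpow_add_rpow ‖x‖ₑ ‖y‖ₑ (p := 2) (by norm_num)
        simpa [show (2 : ℝ) - 1 = 1 by norm_num] using this
    _ ≤ 2 * (ENNReal.ofReal (d * S ^ 2) * 4 ^ shell σ x +
          ENNReal.ofReal (d * S ^ 2) * 4 ^ shell σ y) := by gcongr <;> exact key _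
    _ = _ := by
        rw [mul_assoc 2 (d : ℝ), ENNReal.ofReal_mul (by norm_num : (0 : ℝ) ≤ 2)]
        norm_num; ring

/-- The indices of the level `l` cells in one shell. -/
noncomputable def cellIndices (a : Fin d → ℕ) (l : ℕ) : Finset (Fin d → ℤ) :=
  Fintype.piFinset fun i => Finset.Icc (-2 ^ (l - a i)) (2 ^ (l - a i))

theorem cell_snd_mem {σ : Fin d → ℝ} (hσ : ∀ i, 0 < σ i) (a : Fin d → ℕ) (l : ℕ) (y : Vec d) :
    (cell σ a l y).2 ∈ cellIndices a l := by
  refine Fintype.mem_piFinset.2 fun i => ?_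
  have hp : 0 < σ i * 2 ^ shell σ y := mul_pos (hσ i) (by positivity)
  have hq : (0 : ℝ) < 2 ^ (l - a i) := by positivity
  have h := abs_coord_le hσ y i
  have h1 : |y i / (σ i * 2 ^ shell σ y)| ≤ 1 := by
    rwa [abs_div, abs_of_pos hp, div_le_one hp]
  have ⟨h2, h3⟩ := abs_le.1 h1
  simp only [cell, Finset.mem_Icc]
  constructor
  · rw [Int.le_floor]; push_cast; nlinarith
  · have : ⌊2 ^ (l - a i) * (y i / (σ i * 2 ^ shell σ y))⌋ ≤ ⌊((2 ^ (l - a i) : ℤ) : ℝ)⌋ :=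
      Int.floor_le_floor (by push_cast; nlinarith)
    rwa [Int.floor_intCast] at this

/-- Each coordinate has 2 · 2^k + 1 ≤ 3 · 2^k indices, k = l - aᵢ. The top index 2^k occurs only for
yᵢ = σᵢ 2ⁿ. -/
theorem card_cellIndices_le (a : Fin d → ℕ) (l : ℕ) :
    (cellIndices a l).card ≤ 3 ^ d * 2 ^ ∑ i, (l - a i) := by
  rw [cellIndices, Fintype.card_piFinset, ← Finset.prod_pow_eq_pow_sum,
    show 3 ^ d = ∏ _i : Fin d, 3 by simp, ← Finset.prod_mul_distrib]
  refine Finset.prod_le_prod' fun i _ => ?_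
  rw [Int.card_Icc]
  have : (1 : ℤ) ≤ 2 ^ (l - a i) := one_le_pow₀ (by norm_num)
  have h2 : (((2 : ℕ) ^ (l - a i) : ℕ) : ℤ) = 2 ^ (l - a i) := by push_cast; rfl
  omega

/-- In shell n + 1 some coordinate exceeds 2ⁿ σᵢ in absolute value, which by Markov's inequality for
the sixth power has probability at most 64⁻ⁿ; a union bound over the coordinates gives d. The factor
64 undoes the shift from n + 1 to n and makes n = 0 trivial. -/
theorem measure_shell_eq_le [NeZero d] {σ : Fin d → ℝ} (hσ : ∀ i, 0 < σ i) (μ : Measure (Vec d))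
    [IsProbabilityMeasure μ]
    (hμ : ∀ i, ∫⁻ y, ‖y i‖ₑ ^ 6 ∂μ ≤ ENNReal.ofReal (σ i ^ 6)) (n : ℕ) :
    μ (shell σ ⁻¹' {n}) ≤ 64 * d * (64⁻¹) ^ n := by
  rcases n with _ | n
  · refine prob_le_one.trans ?_
    have : (1 : ℝ≥0∞) ≤ d := by exact_mod_cast NeZero.one_le
    simpa using one_le_mul (by norm_num : (1 : ℝ≥0∞) ≤ 64) this
  have hsub : shell σ ⁻¹' {n + 1} ⊆
      ⋃ i : Fin d, {y : Vec d | ENNReal.ofReal ((2 ^ n * σ i) ^ 6) ≤ ‖y i‖ₑ ^ 6} := by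
    intro y hy
    have h := two_pow_lt_scaledNorm (Set.mem_singleton_iff.1 hy)
    by_contra hcon
    simp only [Set.mem_iUnion, Set.mem_ofPred_eq, not_exists, not_le] at hcon
    refine absurd h (not_lt.2 ((pi_norm_le_iff_of_nonneg (by positivity)).2 fun i => ?_))
    have hi := hcon i
    rw [← ofReal_norm, ← ENNReal.ofReal_pow (norm_nonneg _)] at hi
    have hi' := ENNReal.ofReal_lt_ofReal_iff_of_nonneg (by positivity) |>.1 hi
    have := lt_of_pow_lt_pow_left₀ 6 (mul_nonneg (by positivity) (hσ i).le) hi'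
    rw [norm_div, Real.norm_of_nonneg (hσ i).le, div_le_iff₀ (hσ i)]
    exact this.le
  have hone : ∀ i : Fin d,
      μ {y : Vec d | ENNReal.ofReal ((2 ^ n * σ i) ^ 6) ≤ ‖y i‖ₑ ^ 6} ≤ 64⁻¹ ^ n := by
    intro i
    have h1 := (mul_meas_ge_le_lintegral (μ := μ) (f := fun y : Vec d => ‖y i‖ₑ ^ 6)
      (by fun_prop) (ENNReal.ofReal ((2 ^ n * σ i) ^ 6))).trans (hμ i)
    have e : ENNReal.ofReal ((2 ^ n * σ i) ^ 6) = 64 ^ n * ENNReal.ofReal (σ i ^ 6) := by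
      rw [mul_pow, ← pow_mul, mul_comm n 6, pow_mul, ENNReal.ofReal_mul (by positivity),
        ENNReal.ofReal_pow (by positivity)]
      norm_num
    have hs0 : ENNReal.ofReal (σ i ^ 6) ≠ 0 := by
      have := hσ i
      simp only [ne_eq, ENNReal.ofReal_eq_zero, not_le]; positivity
    have h64 : (64 : ℝ≥0∞) ^ n ≠ 0 := by positivity
    have h64' : (64 : ℝ≥0∞) ^ n ≠ ∞ := ENNReal.pow_ne_top (by norm_num)
    rw [e] at h1 ⊢
    rw [mul_assoc, mul_left_comm] at h1
    have h2 := (ENNReal.mul_le_mul_iff_right hs0 ENNReal.ofReal_ne_top).1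
      (h1.trans_eq (mul_one _).symm)
    rw [← ENNReal.inv_pow, ENNReal.le_inv_iff_mul_le, mul_comm]
    exact h2
  calc μ (shell σ ⁻¹' {n + 1}) ≤ ∑ i : Fin d,
        μ {y : Vec d | ENNReal.ofReal ((2 ^ n * σ i) ^ 6) ≤ ‖y i‖ₑ ^ 6} :=
        (measure_mono hsub).trans (measure_iUnion_fintype_le _ _)
    _ ≤ ∑ _i : Fin d, 64⁻¹ ^ n := Finset.sum_le_sum fun i _ => hone i
    _ = 64 * d * (64⁻¹) ^ (n + 1) := by
      rw [Finset.sum_const, Finset.card_univ, Fintype.card_fin, nsmul_eq_mul, pow_succ,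
        mul_assoc, mul_left_comm, mul_comm (64⁻¹ ^ n), ← mul_assoc (64 : ℝ≥0∞),
        ENNReal.mul_inv_cancel (by norm_num) (by norm_num), one_mul]

/-- The multiscale upper bound for `W₂²`. -/
noncomputable def multiscale (σ : Fin d → ℝ) (a : Fin d → ℕ) (S : ℝ) (L : ℕ)
    (μ ν : Measure (Vec d)) : ℝ≥0∞ :=
  ENNReal.ofReal (d * S ^ 2 / 4 ^ L) * ∫⁻ x, 4 ^ shell σ x ∂μ +
    ∑ k ∈ Finset.range L, ENNReal.ofReal (d * S ^ 2 / 4 ^ k) *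
      imbalance (cell σ a) (fun p => 4 ^ p.1) (k + 1) μ ν +
    ENNReal.ofReal (2 * d * S ^ 2) *
      (imbalance (cell σ a) (fun p => 4 ^ p.1) 0 μ ν +
        imbalance (cell σ a) (fun p => 4 ^ p.1) 0 ν μ)

theorem W2_le_multiscale {σ : Fin d → ℝ} (hσ : ∀ i, 0 < σ i) {a : Fin d → ℕ} {S : ℝ}
    (ha : ∀ i, σ i * 2 ^ a i ≤ S) (L : ℕ) (μ ν : Measure (Vec d)) [IsProbabilityMeasure μ]
    [IsProbabilityMeasure ν] : W2 μ ν ≤ multiscale σ a S L μ ν ^ (1 / 2 : ℝ) := by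
  have hS : ∀ i, σ i ≤ S := fun i =>
    (le_mul_of_one_le_right (hσ i).le (one_le_pow₀ (by norm_num))).trans (ha i)
  obtain ⟨π, h, h1, h2, h3⟩ := exists_coupling_le_imbalance μ ν (c := cell σ a)
    (measurable_cell σ a) (cell_eq_of_cell_succ_eq σ a) (g := fun p => 4 ^ p.1)
    (fun l x => rfl) (K := fun z => ‖z.1 - z.2‖ₑ ^ 2)
    (b := fun l => ENNReal.ofReal (d * S ^ 2 / 4 ^ l))
    (enorm_sub_sq_le_of_cell_eq hσ ha) (enorm_sub_sq_le_shell hσ hS) L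
  exact (W2_le_of_mem_couplings ⟨h, h1, h2⟩).trans (ENNReal.rpow_le_rpow h3 (by norm_num))

end Cells

end RandomField

/-! ### The mean of the multiscale bound for independent outputs. -/

namespace RandomField

section Expectation

theorem lintegral_rpow_half_le {Ω : Type*} [MeasurableSpace Ω] (P : Measure Ω)
    [IsProbabilityMeasure P] {f : Ω → ℝ≥0∞} (hf : AEMeasurable f P) :
    ∫⁻ x, f x ^ (1 / 2 : ℝ) ∂P ≤ (∫⁻ x, f x ∂P) ^ (1 / 2 : ℝ) := by
  have h := ENNReal.lintegral_mul_le_Lp_mul_Lq P (Real.HolderConjugate.two_two)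
    (hf.pow_const (1 / 2 : ℝ)) (aemeasurable_const (b := (1 : ℝ≥0∞)))
  have e : ∀ x, (f x ^ (1 / 2 : ℝ)) ^ (2 : ℝ) = f x := fun x => by
    rw [← ENNReal.rpow_mul]; norm_num
  simpa only [Pi.mul_apply, mul_one, e, ENNReal.one_rpow, lintegral_const, measure_univ] using h

theorem lintegral_enorm_sub_integral_le {Ω : Type*} [MeasurableSpace Ω] (P : Measure Ω)
    [IsProbabilityMeasure P] {X : Ω → ℝ} (hX : MemLp X 2 P) :
    ∫⁻ x, ‖X x - ∫ x', X x' ∂P‖ₑ ∂P ≤ ENNReal.ofReal (Var[X; P]) ^ (1 / 2 : ℝ) := by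
  rw [hX.ofReal_variance_eq, evariance]
  refine le_trans (le_of_eq ?_) (lintegral_rpow_half_le P
    (f := fun x => ‖X x - ∫ x', X x' ∂P‖ₑ ^ 2) ?_)
  · congr 1; ext x
    rw [← ENNReal.rpow_two, ← ENNReal.rpow_mul]; norm_num
  · exact ((hX.aestronglyMeasurable.aemeasurable.sub_const _).enorm.pow_const 2)

theorem variance_average_le {Ω : Type*} [MeasurableSpace Ω] (P : Measure Ω)
    [IsProbabilityMeasure P] {ι : Type*} (s : Finset ι) {X : ι → Ω → ℝ}
    (hX : ∀ j ∈ s, MemLp (X j) 2 P) (hind : iIndepFun X P) {v : ι → ℝ}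
    (hv : ∀ j ∈ s, ∫ x, X j x ^ 2 ∂P ≤ v j) :
    Var[fun x => (s.card : ℝ)⁻¹ * ∑ j ∈ s, X j x; P] ≤ ((s.card : ℝ)⁻¹) ^ 2 * ∑ j ∈ s, v j := by
  have e : (fun x => ∑ j ∈ s, X j x) = ∑ j ∈ s, X j := by ext x; simp
  rw [variance_const_mul, e, IndepFun.variance_sum hX fun i _ j _ hij => hind.indepFun hij]
  gcongr with j hj
  exact (variance_le_expectation_sq (hX j hj).aestronglyMeasurable).trans (hv j hj)

variable {d N : ℕ}

/-- The mean deviation of an empirical measure from the averaged law on a set. -/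
theorem lintegral_enorm_empirical_sub_avg_le {s : Finset (Fin N)} (hs : s.Nonempty)
    (κ : Fin N → Measure (Vec d)) [∀ j, IsProbabilityMeasure (κ j)] {A : Set (Vec d)}
    (hA : MeasurableSet A) :
    ∫⁻ y, ‖(empirical s y A).toReal - (avg s κ A).toReal‖ₑ ∂(Measure.pi κ) ≤
      (avg s κ A / s.card) ^ (1 / 2 : ℝ) := by
  have hm0 : (s.card : ℝ≥0∞) ≠ 0 := by simpa using hs.ne_empty
  let X : Fin N → (Fin N → Vec d) → ℝ := fun j y => A.indicator 1 (y j)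
  have hI : Measurable (A.indicator (1 : Vec d → ℝ)) := measurable_one.indicator hA
  have hXm : ∀ j, Measurable (X j) := fun j => hI.comp (measurable_pi_apply j)
  have hX : ∀ j, MemLp (X j) 2 (Measure.pi κ) := fun j =>
    MemLp.of_bound (hXm j).aestronglyMeasurable 1 (Filter.Eventually.of_forall fun y => by
      by_cases h : y j ∈ A <;> simp [X, h])
  have hind : iIndepFun X (Measure.pi κ) := iIndepFun_pi fun j => hI.aemeasurable
  have hint : ∀ j, ∫ y, X j y ∂(Measure.pi κ) = (κ j A).toReal := by
    intro j
    have := (measurePreserving_eval κ j).map_eq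
    rw [show (∫ y, X j y ∂(Measure.pi κ)) = ∫ y, A.indicator 1 (Function.eval j y) ∂(Measure.pi κ)
      from rfl, ← integral_map (measurable_pi_apply j).aemeasurable hI.aestronglyMeasurable, this,
      integral_indicator_one hA]
    rfl
  -- The second moment of an indicator is its probability, so the variance of the average is at most
  -- the averaged probability divided by the sample size.
  have hv := variance_average_le (Measure.pi κ) s (fun j _ => hX j) hind
    (v := fun j => (κ j A).toReal) (fun j _ => by
      rw [← hint j]
      refine le_of_eq (integral_congr_ae (Filter.Eventually.of_forall fun y => ?_))
      by_cases h : y j ∈ A <;> simp [X, h])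
  have havg : (avg s κ A).toReal = (s.card : ℝ)⁻¹ * ∑ j ∈ s, (κ j A).toReal := by
    rw [avg_apply, ENNReal.toReal_mul, ENNReal.toReal_sum fun j _ => measure_ne_top _ _]; simp
  have hemp : ∀ y, (empirical s y A).toReal = (s.card : ℝ)⁻¹ * ∑ j ∈ s, X j y := by
    intro y
    rw [empirical_eq_avg, avg_apply, ENNReal.toReal_mul,
      ENNReal.toReal_sum fun j _ => measure_ne_top _ _]
    simp only [Measure.dirac_apply' _ hA, X, ENNReal.toReal_inv, ENNReal.toReal_natCast]
    congr 1
    refine Finset.sum_congr rfl fun j _ => ?_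
    by_cases h : y j ∈ A <;> simp [h]
  have hmean : ∫ y, (s.card : ℝ)⁻¹ * ∑ j ∈ s, X j y ∂(Measure.pi κ) = (avg s κ A).toReal := by
    rw [integral_const_mul, integral_finsetSum _ fun j _ => (hX j).integrable (by norm_num), havg]
    simp only [hint]
  have hZ : MemLp (fun y => (s.card : ℝ)⁻¹ * ∑ j ∈ s, X j y) 2 (Measure.pi κ) :=
    (memLp_finsetSum s fun j _ => hX j).const_mul _
  have key := lintegral_enorm_sub_integral_le (Measure.pi κ) hZ
  rw [hmean] at key
  simp only [hemp]
  refine key.trans (ENNReal.rpow_le_rpow ?_ (by norm_num))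
  have hfin : avg s κ A / s.card ≠ ∞ := by
    refine ENNReal.div_ne_top ?_ hm0
    have := isProbabilityMeasure_avg hs κ fun j _ => inferInstance
    exact measure_ne_top _ _
  refine ENNReal.ofReal_le_of_le_toReal (hv.trans_eq ?_)
  rw [ENNReal.toReal_div, havg, ENNReal.toReal_natCast]
  field_simp

theorem tsub_le_enorm_toReal_sub {p q : ℝ≥0∞} (hp : p ≠ ∞) (hq : q ≠ ∞) :
    p - q ≤ ‖q.toReal - p.toReal‖ₑ := by
  conv_lhs => rw [← ENNReal.ofReal_toReal hp, ← ENNReal.ofReal_toReal hq]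
  rw [← ENNReal.ofReal_sub _ ENNReal.toReal_nonneg, ← ofReal_norm]
  refine ENNReal.ofReal_le_ofReal ?_
  rw [Real.norm_eq_abs, abs_sub_comm]
  exact le_abs_self _

theorem sum_rpow_half_le {ι : Type*} (s : Finset ι) (f : ι → ℝ≥0∞) :
    ∑ i ∈ s, f i ^ (1 / 2 : ℝ) ≤ (s.card * ∑ i ∈ s, f i) ^ (1 / 2 : ℝ) := by
  have h := ENNReal.inner_le_Lp_mul_Lq s (fun _ => (1 : ℝ≥0∞)) (fun i => f i ^ (1 / 2 : ℝ))
    Real.HolderConjugate.two_two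
  have e : ∀ i, (f i ^ (1 / 2 : ℝ)) ^ (2 : ℝ) = f i := fun x => by
    rw [← ENNReal.rpow_mul]; norm_num
  rw [ENNReal.mul_rpow_of_nonneg _ _ (by norm_num)]
  simpa only [one_mul, ENNReal.one_rpow, Finset.sum_const, nsmul_eq_mul, mul_one, e] using h

theorem measurable_empirical_apply (s : Finset (Fin N)) {A : Set (Vec d)} (hA : MeasurableSet A) :
    Measurable fun y : Fin N → Vec d => empirical s y A := by
  simp only [empirical_eq_avg, avg_apply, Measure.dirac_apply' _ hA]
  refine Measurable.const_mul (Finset.measurable_fun_sum s fun j _ => ?_) _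
  exact (measurable_one.indicator hA).comp (measurable_pi_apply j)

theorem imbalance_cell_eq {σ : Fin d → ℝ} (hσ : ∀ i, 0 < σ i) (a : Fin d → ℕ) (l : ℕ)
    (μ ν : Measure (Vec d)) :
    imbalance (cell σ a) (fun p => 4 ^ p.1) l μ ν =
      ∑' n : ℕ, ∑ k ∈ cellIndices a l,
        4 ^ n * (μ (cell σ a l ⁻¹' {(n, k)}) - ν (cell σ a l ⁻¹' {(n, k)})) := by
  rw [imbalance, ENNReal.tsum_prod']
  refine tsum_congr fun n => tsum_eq_sum fun k hk => ?_
  have : cell σ a l ⁻¹' {(n, k)} = ∅ := by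
    ext y
    simp only [Set.mem_preimage, Set.mem_singleton_iff, Set.mem_empty_iff_false, iff_false]
    intro h
    exact hk (by simpa [h] using cell_snd_mem hσ a l y)
  simp [this]

theorem sum_cell_measure_le (σ : Fin d → ℝ) (a : Fin d → ℕ) (l n : ℕ) (μ : Measure (Vec d))
    (t : Finset (Fin d → ℤ)) :
    ∑ k ∈ t, μ (cell σ a l ⁻¹' {(n, k)}) ≤ μ (shell σ ⁻¹' {n}) := by
  rw [← measure_biUnion_finset]
  · refine measure_mono fun y hy => ?_
    simp only [Set.mem_iUnion, Set.mem_preimage, Set.mem_singleton_iff] at hy ⊢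
    obtain ⟨k, _, hk⟩ := hy
    exact congrArg Prod.fst hk
  · intro k _ k' _ hkk'
    refine Set.disjoint_left.2 fun y hy hy' => hkk' ?_
    simp only [Set.mem_preimage, Set.mem_singleton_iff] at hy hy'
    exact congrArg Prod.snd (hy.symm.trans hy')
  · exact fun k _ => measurable_cell σ a l (measurableSet_singleton _)

theorem avg_shell_eq_le [NeZero d] {σ : Fin d → ℝ} (hσ : ∀ i, 0 < σ i) (s : Finset (Fin N))
    (κ : Fin N → Measure (Vec d)) [∀ j, IsProbabilityMeasure (κ j)]
    (hκ : ∀ j i, ∫⁻ y, ‖y i‖ₑ ^ 6 ∂(κ j) ≤ ENNReal.ofReal (σ i ^ 6)) (n : ℕ) :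
    avg s κ (shell σ ⁻¹' {n}) ≤ 64 * d * (64⁻¹) ^ n := by
  rw [avg_apply]
  exact inv_card_mul_sum_le fun j _ => measure_shell_eq_le hσ (κ j) (hκ j) n

/-- Here the sixth moments pay off: the squared size 4ⁿ of the n-th shell, times the square root 8⁻ⁿ
of its mass bound, leaves the summable 2⁻ⁿ. Fourth moments would leave no decay. -/
theorem four_pow_mul_rpow_half (c : ℝ≥0∞) (n : ℕ) :
    (4 : ℝ≥0∞) ^ n * (c * (64⁻¹) ^ n) ^ (1 / 2 : ℝ) = c ^ (1 / 2 : ℝ) * 2⁻¹ ^ n := by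
  rw [ENNReal.mul_rpow_of_nonneg _ _ (by norm_num)]
  have e : (64⁻¹ : ℝ≥0∞) = (8⁻¹) ^ 2 := by
    rw [← ENNReal.inv_pow]; norm_num
  have e2 : (((64⁻¹ : ℝ≥0∞)) ^ n) ^ (1 / 2 : ℝ) = 8⁻¹ ^ n := by
    rw [e, ← pow_mul, mul_comm, pow_mul, ← ENNReal.rpow_two, ← ENNReal.rpow_mul]; norm_num
  rw [e2, mul_left_comm, ← mul_pow]
  congr 2
  rw [show (8 : ℝ≥0∞) = 4 * 2 by norm_num, ENNReal.mul_inv (by norm_num) (by norm_num),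
    ← mul_assoc, ENNReal.mul_inv_cancel (by norm_num) (by norm_num), one_mul]

theorem tsum_inv_two_pow : ∑' n : ℕ, (2⁻¹ : ℝ≥0∞) ^ n = 2 := by
  rw [ENNReal.tsum_geometric, ENNReal.one_sub_inv_two, inv_inv]

/-- If the discrepancy is controlled by the standard deviation on every cell, then so is the
imbalance on average. -/
theorem lintegral_imbalance_le [NeZero d] {σ : Fin d → ℝ} (hσ : ∀ i, 0 < σ i) (a : Fin d → ℕ)
    (l : ℕ) {s : Finset (Fin N)}
    (κ : Fin N → Measure (Vec d)) [∀ j, IsProbabilityMeasure (κ j)]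
    (hκ : ∀ j i, ∫⁻ y, ‖y i‖ₑ ^ 6 ∂(κ j) ≤ ENNReal.ofReal (σ i ^ 6))
    {μ ν : (Fin N → Vec d) → Measure (Vec d)}
    (hmeas : ∀ A, MeasurableSet A → Measurable fun y => μ y A - ν y A)
    (hle : ∀ A, MeasurableSet A →
      ∫⁻ y, (μ y A - ν y A) ∂(Measure.pi κ) ≤ (avg s κ A / s.card) ^ (1 / 2 : ℝ)) :
    ∫⁻ y, imbalance (cell σ a) (fun p => 4 ^ p.1) l (μ y) (ν y) ∂(Measure.pi κ) ≤
      2 * ((cellIndices a l).card * (64 * d) / s.card) ^ (1 / 2 : ℝ) := by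
  have hcell : ∀ p, MeasurableSet (cell σ a l ⁻¹' {p}) := fun p =>
    measurable_cell σ a l (measurableSet_singleton p)
  simp only [imbalance_cell_eq hσ]
  rw [lintegral_tsum fun n => (Finset.measurable_fun_sum _ fun k _ =>
    (hmeas _ (hcell (n, k))).const_mul _).aemeasurable]
  calc ∑' n : ℕ, ∫⁻ y, ∑ k ∈ cellIndices a l, 4 ^ n *
        (μ y (cell σ a l ⁻¹' {(n, k)}) - ν y (cell σ a l ⁻¹' {(n, k)})) ∂(Measure.pi κ)
      ≤ ∑' n : ℕ, (((cellIndices a l).card : ℝ≥0∞) * (64 * d) / s.card) ^ (1 / 2 : ℝ) *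
          (2⁻¹ : ℝ≥0∞) ^ n := by
        refine ENNReal.tsum_le_tsum fun n => ?_
        rw [lintegral_finsetSum _ fun k _ => (hmeas _ (hcell (n, k))).const_mul _]
        calc ∑ k ∈ cellIndices a l, ∫⁻ y, 4 ^ n *
              (μ y (cell σ a l ⁻¹' {(n, k)}) - ν y (cell σ a l ⁻¹' {(n, k)})) ∂(Measure.pi κ)
            ≤ ∑ k ∈ cellIndices a l,
                4 ^ n * (avg s κ (cell σ a l ⁻¹' {(n, k)}) / s.card) ^ (1 / 2 : ℝ) := by
              refine Finset.sum_le_sum fun k _ => ?_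
              rw [lintegral_const_mul _ (hmeas _ (hcell (n, k)))]
              gcongr
              exact hle _ (hcell (n, k))
          -- Cauchy–Schwarz over the cells of one shell: the sum of square roots of masses becomes
          -- the root of the number of cells times the mass of the shell.
          _ ≤ 4 ^ n * ((cellIndices a l).card *
                ((64 * d * (64⁻¹) ^ n) / s.card)) ^ (1 / 2 : ℝ) := by
              rw [← Finset.mul_sum]
              gcongr
              refine (sum_rpow_half_le _ _).trans ?_
              gcongr
              simp only [div_eq_mul_inv]
              rw [← Finset.sum_mul]
              gcongr
              exact (sum_cell_measure_le σ a l n _ _).trans (avg_shell_eq_le hσ s κ hκ n)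
          _ = _ := by
              rw [← four_pow_mul_rpow_half]
              congr 2
              simp only [div_eq_mul_inv]
              ring
    _ = _ := by rw [ENNReal.tsum_mul_left, tsum_inv_two_pow, mul_comm]

theorem lintegral_four_pow_shell_le [NeZero d] {σ : Fin d → ℝ} (hσ : ∀ i, 0 < σ i)
    (s : Finset (Fin N)) (κ : Fin N → Measure (Vec d)) [∀ j, IsProbabilityMeasure (κ j)]
    (hκ : ∀ j i, ∫⁻ y, ‖y i‖ₑ ^ 6 ∂(κ j) ≤ ENNReal.ofReal (σ i ^ 6)) :
    ∫⁻ x, 4 ^ shell σ x ∂(avg s κ) ≤ 2 * (64 * d) := by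
  rw [lintegral_comp_eq_tsum_fiber (avg s κ) (measurable_shell σ) fun n => 4 ^ n]
  calc ∑' n : ℕ, 4 ^ n * avg s κ (shell σ ⁻¹' {n}) ≤
      ∑' n : ℕ, 64 * (d : ℝ≥0∞) * 2⁻¹ ^ n := by
        refine ENNReal.tsum_le_tsum fun n => ?_
        calc 4 ^ n * avg s κ (shell σ ⁻¹' {n}) ≤ 4 ^ n * (64 * d * (64⁻¹) ^ n) := by
              gcongr; exact avg_shell_eq_le hσ s κ hκ n
          _ = 64 * d * (4 * 64⁻¹) ^ n := by rw [mul_pow]; ring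
          _ ≤ 64 * d * 2⁻¹ ^ n := by
              gcongr
              rw [← ENNReal.div_eq_inv_mul.trans (mul_comm _ _),
                ENNReal.div_le_iff (by norm_num) (by norm_num), show (64 : ℝ≥0∞) = 2 * 32 by norm_num, ← mul_assoc,
                ENNReal.inv_mul_cancel (by norm_num) (by norm_num)]
              norm_num
    _ = _ := by rw [ENNReal.tsum_mul_left, tsum_inv_two_pow, mul_comm]

theorem measurable_avg_of_measurable {T : Type*} [MeasurableSpace T] (s : Finset (Fin N))
    {κ : Fin N → T → Measure (Vec d)} (hκ : ∀ j, Measurable (κ j)) :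
    Measurable fun t => avg s fun j => κ j t := by
  refine Measure.measurable_of_measurable_coe _ fun A hA => ?_
  simp only [avg_apply]
  exact (Finset.measurable_fun_sum s fun j _ =>
    (Measure.measurable_coe hA).comp (hκ j)).const_mul _

theorem measurable_imbalance (σ : Fin d → ℝ) (a : Fin d → ℕ) (l : ℕ) {T : Type*}
    [MeasurableSpace T] {μ ν : T → Measure (Vec d)} (hμ : Measurable μ) (hν : Measurable ν) :
    Measurable fun t => imbalance (cell σ a) (fun p => 4 ^ p.1) l (μ t) (ν t) := by
  refine Measurable.tsum fun p => Measurable.const_mul ?_ _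
  have hp := measurable_cell σ a l (measurableSet_singleton p)
  exact ((Measure.measurable_coe hp).comp hμ).sub ((Measure.measurable_coe hp).comp hν)

/-- Unlike the infimum over couplings, the multiscale bound is built from cell masses and one
integral, so its measurability in the pair of measures is immediate. -/
theorem measurable_multiscale (σ : Fin d → ℝ) (a : Fin d → ℕ) (S : ℝ) (L : ℕ) {T : Type*}
    [MeasurableSpace T] {μ ν : T → Measure (Vec d)} (hμ : Measurable μ) (hν : Measurable ν) :
    Measurable fun t => multiscale σ a S L (μ t) (ν t) := by
  have h4 : Measurable fun x => (4 : ℝ≥0∞) ^ shell σ x :=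
    (measurable_of_countable fun n : ℕ => (4 : ℝ≥0∞) ^ n).comp (measurable_shell σ)
  refine Measurable.add (Measurable.add ?_ ?_) ?_
  · exact ((Measure.measurable_lintegral h4).comp hμ).const_mul _
  · exact Finset.measurable_fun_sum _ fun k _ => (measurable_imbalance σ a _ hμ hν).const_mul _
  · exact ((measurable_imbalance σ a _ hμ hν).add (measurable_imbalance σ a _ hν hμ)).const_mul _

theorem measurable_empirical (s : Finset (Fin N)) :
    Measurable fun y : Fin N → Vec d => empirical s y :=
  measurable_avg_of_measurable s fun j => Measure.measurable_dirac.comp (measurable_pi_apply j)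

theorem lintegral_multiscale_le [NeZero d] {σ : Fin d → ℝ} (hσ : ∀ i, 0 < σ i) (a : Fin d → ℕ)
    (S : ℝ) (L : ℕ) {s : Finset (Fin N)} (hs : s.Nonempty)
    (κ : Fin N → Measure (Vec d)) [∀ j, IsProbabilityMeasure (κ j)]
    (hκ : ∀ j i, ∫⁻ y, ‖y i‖ₑ ^ 6 ∂(κ j) ≤ ENNReal.ofReal (σ i ^ 6)) :
    ∫⁻ y, multiscale σ a S L (avg s κ) (empirical s y) ∂(Measure.pi κ) ≤
      ENNReal.ofReal (d * S ^ 2 / 4 ^ L) * (2 * (64 * d)) +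
      ∑ k ∈ Finset.range L, ENNReal.ofReal (d * S ^ 2 / 4 ^ k) *
        (2 * ((cellIndices a (k + 1)).card * (64 * d) / s.card) ^ (1 / 2 : ℝ)) +
      ENNReal.ofReal (2 * d * S ^ 2) *
        (2 * ((cellIndices a 0).card * (64 * d) / s.card) ^ (1 / 2 : ℝ) +
          2 * ((cellIndices a 0).card * (64 * d) / s.card) ^ (1 / 2 : ℝ)) := by
  have hp := isProbabilityMeasure_avg hs κ fun j _ => inferInstance
  have hpe : ∀ y : Fin N → Vec d, IsProbabilityMeasure (empirical s y) := fun y =>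
    isProbabilityMeasure_avg hs _ fun j _ => inferInstance
  have hme := measurable_empirical (d := d) s
  have m1 : ∀ l, Measurable fun y => imbalance (cell σ a) (fun p => 4 ^ p.1) l (avg s κ)
      (empirical s y) := fun l => measurable_imbalance σ a l measurable_const hme
  have m2 : ∀ l, Measurable fun y => imbalance (cell σ a) (fun p => 4 ^ p.1) l
      (empirical s y) (avg s κ) := fun l => measurable_imbalance σ a l hme measurable_const
  have b1 : ∀ l, ∫⁻ y, imbalance (cell σ a) (fun p => 4 ^ p.1) l (avg s κ) (empirical s y)
      ∂(Measure.pi κ) ≤ 2 * ((cellIndices a l).card * (64 * d) / s.card) ^ (1 / 2 : ℝ) := by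
    intro l
    refine lintegral_imbalance_le hσ a l κ hκ (μ := fun _ => avg s κ)
      (fun A hA => measurable_const.sub (measurable_empirical_apply s hA)) fun A hA => ?_
    refine (lintegral_mono fun y => ?_).trans (lintegral_enorm_empirical_sub_avg_le hs κ hA)
    exact tsub_le_enorm_toReal_sub (measure_ne_top _ _) (measure_ne_top _ _)
  have b2 : ∀ l, ∫⁻ y, imbalance (cell σ a) (fun p => 4 ^ p.1) l (empirical s y) (avg s κ)
      ∂(Measure.pi κ) ≤ 2 * ((cellIndices a l).card * (64 * d) / s.card) ^ (1 / 2 : ℝ) := by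
    intro l
    refine lintegral_imbalance_le hσ a l κ hκ (ν := fun _ => avg s κ)
      (fun A hA => (measurable_empirical_apply s hA).sub_const _) fun A hA => ?_
    refine (lintegral_mono fun y => ?_).trans (lintegral_enorm_empirical_sub_avg_le hs κ hA)
    refine (tsub_le_enorm_toReal_sub (measure_ne_top _ _) (measure_ne_top _ _)).trans_eq ?_
    rw [enorm_sub_rev]
  have m3 : Measurable fun y => ∑ k ∈ Finset.range L, ENNReal.ofReal (d * S ^ 2 / 4 ^ k) *
      imbalance (cell σ a) (fun p => 4 ^ p.1) (k + 1) (avg s κ) (empirical s y) :=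
    Finset.measurable_fun_sum _ fun k _ => (m1 (k + 1)).const_mul _
  unfold multiscale
  rw [lintegral_add_left (by fun_prop), lintegral_add_left measurable_const,
    lintegral_finsetSum _ fun k _ => (m1 (k + 1)).const_mul _,
    lintegral_const_mul _ ((m1 0).fun_add (m2 0)), lintegral_add_left (m1 0), lintegral_const,
    measure_univ, mul_one]
  gcongr with k hk
  · exact lintegral_four_pow_shell_le hσ s κ hκ
  · rw [lintegral_const_mul _ (m1 (k + 1))]
    gcongr
    exact b1 (k + 1)
  · exact b1 0
  · exact b2 0

end Expectation

end RandomField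

/-! ### From the choice of scales to the rates. -/

namespace RandomField

section Rates

variable {d N : ℕ}

/-- The dimensional constant in the multiscale estimate. -/
noncomputable def scaleConst (d : ℕ) : ℝ := 128 * d ^ 2 + 8 * d * √(3 ^ d * (64 * d))

/-- The sum over the levels `0, …, L` of the standard deviations for a sample of size `m`. -/
noncomputable def scaleSum (a : Fin d → ℕ) (L : ℕ) (m : ℝ) : ℝ :=
  1 / 4 ^ L + ∑ k ∈ Finset.range (L + 1), √(2 ^ (∑ i, (k - a i)) / m) / 4 ^ k

theorem scaleConst_nonneg (d : ℕ) : 0 ≤ scaleConst d := by unfold scaleConst; positivity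

theorem scaleSum_nonneg (a : Fin d → ℕ) (L : ℕ) (m : ℝ) : 0 ≤ scaleSum a L m := by
  unfold scaleSum; positivity

theorem cell_deviation_le (a : Fin d → ℕ) (l : ℕ) {m : ℕ} (hm : 1 ≤ m) :
    (((cellIndices a l).card : ℝ≥0∞) * (64 * d) / m) ^ (1 / 2 : ℝ) ≤
      ENNReal.ofReal (√(3 ^ d * (64 * d)) * √(2 ^ (∑ i, (l - a i)) / m)) := by
  have hm' : (0 : ℝ) < m := by exact_mod_cast hm
  rw [← Real.sqrt_mul (by positivity), Real.sqrt_eq_rpow,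
    ← ENNReal.ofReal_rpow_of_nonneg (by positivity) (by norm_num)]
  refine ENNReal.rpow_le_rpow ?_ (by norm_num)
  rw [← mul_div_assoc, ENNReal.ofReal_div_of_pos hm', ENNReal.ofReal_natCast]
  gcongr
  calc ((cellIndices a l).card : ℝ≥0∞) * (64 * d)
      ≤ ((3 ^ d * 2 ^ ∑ i, (l - a i) : ℕ) : ℝ≥0∞) * (64 * d) := by
        gcongr; exact card_cellIndices_le a l
    _ = ENNReal.ofReal (((3 ^ d * 2 ^ (∑ i, (l - a i)) * (64 * d) : ℕ) : ℝ)) := by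
        rw [ENNReal.ofReal_natCast]; push_cast; rfl
    _ ≤ _ := by
        refine ENNReal.ofReal_le_ofReal (le_of_eq ?_)
        push_cast; ring

theorem lintegral_multiscale_le_scaleSum [NeZero d] {σ : Fin d → ℝ} (hσ : ∀ i, 0 < σ i)
    (a : Fin d → ℕ) (S : ℝ) (L : ℕ) {s : Finset (Fin N)} (hs : s.Nonempty)
    (κ : Fin N → Measure (Vec d)) [∀ j, IsProbabilityMeasure (κ j)]
    (hκ : ∀ j i, ∫⁻ y, ‖y i‖ₑ ^ 6 ∂(κ j) ≤ ENNReal.ofReal (σ i ^ 6)) :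
    ∫⁻ y, multiscale σ a S L (avg s κ) (empirical s y) ∂(Measure.pi κ) ≤
      ENNReal.ofReal (S ^ 2 * (scaleConst d * scaleSum a L s.card)) := by
  have hm : 1 ≤ s.card := hs.card_pos
  set q : ℕ → ℝ := fun l => √(3 ^ d * (64 * d)) * √(2 ^ (∑ i, (l - a i)) / s.card) with hq
  have hq0 : ∀ l, 0 ≤ q l := fun l => by positivity
  have two : ∀ x : ℝ, 0 ≤ x → 2 * ENNReal.ofReal x = ENNReal.ofReal (2 * x) := fun x hx => by
    rw [ENNReal.ofReal_mul (by norm_num)]; norm_num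
  refine (lintegral_multiscale_le hσ a S L hs κ hκ).trans ?_
  calc _ ≤ ENNReal.ofReal (d * S ^ 2 / 4 ^ L) * ENNReal.ofReal (2 * (64 * d)) +
      ∑ k ∈ Finset.range L, ENNReal.ofReal (d * S ^ 2 / 4 ^ k) * ENNReal.ofReal (2 * q (k + 1)) +
      ENNReal.ofReal (2 * d * S ^ 2) * (ENNReal.ofReal (2 * q 0) + ENNReal.ofReal (2 * q 0)) := by
        have e : ENNReal.ofReal (2 * (64 * d)) = 2 * (64 * d) := by
          rw [← two _ (by positivity), ENNReal.ofReal_mul (by norm_num)]; norm_num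
        rw [e]
        simp only [← two _ (hq0 _)]
        gcongr <;> exact cell_deviation_le a _ hm
    _ = ENNReal.ofReal (d * S ^ 2 / 4 ^ L * (2 * (64 * d)) +
          ∑ k ∈ Finset.range L, d * S ^ 2 / 4 ^ k * (2 * q (k + 1)) +
          2 * d * S ^ 2 * (2 * q 0 + 2 * q 0)) := by
        have hnn : ∀ k ∈ Finset.range L, 0 ≤ d * S ^ 2 / 4 ^ k * (2 * q (k + 1)) := fun k _ =>
          mul_nonneg (by positivity) (mul_nonneg (by norm_num) (hq0 _))
        have h0 := hq0 0
        rw [ENNReal.ofReal_add (add_nonneg (by positivity) (Finset.sum_nonneg hnn)) (by positivity),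
          ENNReal.ofReal_add (by positivity) (Finset.sum_nonneg hnn),
          ENNReal.ofReal_sum_of_nonneg hnn,
          ENNReal.ofReal_mul (p := d * S ^ 2 / 4 ^ L) (by positivity),
          ENNReal.ofReal_mul (p := 2 * d * S ^ 2) (by positivity),
          ENNReal.ofReal_add (by positivity) (by positivity)]
        congr 2
        refine Finset.sum_congr rfl fun k _ => (ENNReal.ofReal_mul (by positivity)).symm
    _ ≤ _ := by
        refine ENNReal.ofReal_le_ofReal ?_
        set w := √(3 ^ d * (64 * d) : ℝ) with hw
        have hw0 : 0 ≤ w := Real.sqrt_nonneg _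
        -- At positive levels, 8 = 2 · 4, where 4 comes from pairing the cost of level k with the
        -- deviation at level k + 1. At level 0, 8 = 2 · (2 + 2), from the two directions of the
        -- excess between shells.
        have hsum : ∑ k ∈ Finset.range L, d * S ^ 2 / 4 ^ k * (2 * q (k + 1)) +
            2 * d * S ^ 2 * (2 * q 0 + 2 * q 0) = 8 * d * S ^ 2 * w *
            ∑ k ∈ Finset.range (L + 1), √(2 ^ (∑ i, (k - a i)) / s.card) / 4 ^ k := by
          rw [Finset.sum_range_succ', mul_add (8 * d * S ^ 2 * w), Finset.mul_sum]
          congr 1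
          · refine Finset.sum_congr rfl fun k _ => ?_
            simp only [hq, pow_succ]; field_simp; ring
          · simp only [hq, pow_zero, div_one]; ring
        rw [add_assoc, hsum, scaleSum, scaleConst, ← hw]
        set T := ∑ k ∈ Finset.range (L + 1), √(2 ^ (∑ i, (k - a i)) / (s.card : ℝ)) / 4 ^ k with hT
        have hT0 : 0 ≤ T := by positivity
        have h1 : 0 ≤ S ^ 2 * (128 * d ^ 2 * T) := by positivity
        have h2 : 0 ≤ S ^ 2 * (8 * d * w * (1 / 4 ^ L)) := by positivity
        calc _ = S ^ 2 * (128 * d ^ 2 * (1 / 4 ^ L)) + S ^ 2 * (8 * d * w * T) := by ring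
          _ ≤ _ := by linarith

/-- The mean `W₂` distance, through the measurable upper bound `multiscale`. -/
theorem lintegral_multiscale_rpow_half_le [NeZero d] {σ : Fin d → ℝ} (hσ : ∀ i, 0 < σ i)
    (a : Fin d → ℕ) {S : ℝ} (hS : 0 ≤ S) (L : ℕ) {s : Finset (Fin N)} (hs : s.Nonempty)
    (κ : Fin N → Measure (Vec d)) [∀ j, IsProbabilityMeasure (κ j)]
    (hκ : ∀ j i, ∫⁻ y, ‖y i‖ₑ ^ 6 ∂(κ j) ≤ ENNReal.ofReal (σ i ^ 6)) :
    ∫⁻ y, multiscale σ a S L (avg s κ) (empirical s y) ^ (1 / 2 : ℝ) ∂(Measure.pi κ) ≤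
      ENNReal.ofReal (S * √(scaleConst d * scaleSum a L s.card)) := by
  have hm : Measurable fun y : Fin N → Vec d => multiscale σ a S L (avg s κ) (empirical s y) :=
    measurable_multiscale σ a S L measurable_const (measurable_empirical s)
  refine (lintegral_rpow_half_le _ hm.aemeasurable).trans ?_
  refine (ENNReal.rpow_le_rpow (lintegral_multiscale_le_scaleSum hσ a S L hs κ hκ)
    (by norm_num)).trans_eq ?_
  rw [ENNReal.ofReal_rpow_of_nonneg (mul_nonneg (sq_nonneg S)
    (mul_nonneg (scaleConst_nonneg d) (scaleSum_nonneg a L _))) (by norm_num), ← Real.sqrt_eq_rpow,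
    Real.sqrt_mul (sq_nonneg S), Real.sqrt_sq hS]

/-- For d ≤ 4 each level contributes at most 1/√m, because √(2^(dk)) ≤ 4^k, and about log₂ m levels
bring 4^(-L) down to 4/√m. As log 2 ≥ 1/2, the total 5 + L is at most (10 + 2) log(1 + m). -/
theorem scaleSum_le_log (hd : d ≤ 4) {m : ℕ} (hm : 1 ≤ m) :
    scaleSum (fun _ : Fin d => 0) (Nat.log 2 m) m ≤ 12 * (Real.log (1 + m) / √m) := by
  have hm' : (1 : ℝ) ≤ m := by exact_mod_cast hm
  have hs : 0 < √(m : ℝ) := Real.sqrt_pos.2 (by linarith)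
  have hlog2 : (1 / 2 : ℝ) ≤ Real.log 2 := by have := Real.log_two_gt_d9; linarith
  have hL : (Nat.log 2 m : ℝ) * Real.log 2 ≤ Real.log (1 + m) := by
    rw [← Real.log_pow]
    refine Real.log_le_log (by positivity) ?_
    have := Nat.pow_log_le_self 2 (by omega : m ≠ 0)
    have : ((2 ^ Nat.log 2 m : ℕ) : ℝ) ≤ m := by exact_mod_cast this
    push_cast at this; linarith
  have h1 : Real.log 2 ≤ Real.log (1 + m) := Real.log_le_log (by norm_num) (by linarith)
  have hterm : ∀ k ∈ Finset.range (Nat.log 2 m + 1),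
      √(2 ^ (∑ _i : Fin d, (k - 0)) / (m : ℝ)) / 4 ^ k ≤ 1 / √m := by
    intro k _
    rw [Real.sqrt_div (by positivity), div_div, div_le_div_iff₀ (by positivity) hs, one_mul,
      mul_comm (√(m : ℝ))]
    gcongr
    refine Real.sqrt_le_iff.2 ⟨by positivity, ?_⟩
    rw [← pow_mul, show (4 : ℝ) = 2 ^ 2 by norm_num, ← pow_mul]
    refine pow_le_pow_right₀ (by norm_num) ?_
    simp only [tsub_zero, Finset.sum_const, Finset.card_univ, Fintype.card_fin, smul_eq_mul]
    nlinarith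
  have h4 : 1 / (4 : ℝ) ^ Nat.log 2 m ≤ 4 / √m := by
    rw [div_le_div_iff₀ (by positivity) hs, one_mul]
    have h := Nat.lt_pow_succ_log_self (b := 2) (by norm_num) m
    have h' : (m : ℝ) ≤ 2 ^ (Nat.log 2 m) * 2 := by
      rw [← pow_succ]; exact_mod_cast h.le
    have h24 : (2 : ℝ) ^ (Nat.log 2 m) ≤ 4 ^ (Nat.log 2 m) := by gcongr; norm_num
    have : √(m : ℝ) ≤ m := Real.sqrt_le_iff.2 ⟨by linarith, by nlinarith⟩
    have hp : (0 : ℝ) < 4 ^ (Nat.log 2 m) := by positivity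
    linarith
  rw [scaleSum]
  calc _ ≤ 4 / √m + ∑ k ∈ Finset.range (Nat.log 2 m + 1), 1 / √(m : ℝ) :=
        add_le_add h4 (Finset.sum_le_sum hterm)
    _ = (5 + Nat.log 2 m) / √m := by
        rw [Finset.sum_const, Finset.card_range, nsmul_eq_mul]; push_cast; field_simp; ring
    _ ≤ _ := by
        rw [← mul_div_assoc]
        gcongr
        have hn : (0 : ℝ) ≤ Nat.log 2 m := by positivity
        nlinarith

/-- For d > 4 the terms from level A on grow geometrically with ratio 2^(d/2)/4 > 1, so the finest
level dominates. Stopping at 2^L ≈ u balances it against 4^(-L), both of order u^(-2). The levels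
below A are bounded crudely by 2^(dA)/√m each. -/
theorem scaleSum_le_of_eventually_le (hd : 4 < d) (a : Fin d → ℕ) {A : ℕ} {ρ m u : ℝ} (hρ : 0 < ρ)
    (hm : 0 < m) (hu : 1 ≤ u) (hum : u ^ d = m / ρ)
    (hA : ∀ k, A ≤ k → (2 : ℝ) ^ (∑ i, (k - a i)) ≤ 2 ^ d * ρ * (2 ^ d) ^ k) :
    ∃ L : ℕ, scaleSum a L m ≤ (1 + 3 * 4 ^ d) / u ^ 2 + A * 2 ^ (d * A) / √m := by
  -- With L = n + 1, this places 2^L between u and 2u.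
  obtain ⟨n, hn1, hn2⟩ := exists_nat_pow_near hu (by norm_num : (1 : ℝ) < 2)
  have hu0 : 0 < u := by linarith
  have ht : 0 < m / ρ := by positivity
  set L := n + 1 with hL
  have hL2 : (2 : ℝ) ^ L ≤ 2 * u := by rw [hL, pow_succ]; linarith
  set w := √((2 : ℝ) ^ d) with hw
  have hw2 : w ^ 2 = 2 ^ d := Real.sq_sqrt (by positivity)
  have hw0 : 0 ≤ w := Real.sqrt_nonneg _
  have hd5 : (32 : ℝ) ≤ 2 ^ d := by
    calc (32 : ℝ) = 2 ^ 5 := by norm_num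
      _ ≤ 2 ^ d := pow_le_pow_right₀ (by norm_num) hd
  set β := w / 4 with hβ
  -- From d ≥ 5, β = 2^(d/2)/4 ≥ √2. The bound 4/3 gives 1/(β - 1) ≤ 3, the constant in the
  -- geometric sum.
  have hβ1 : 4 / 3 ≤ β := by nlinarith
  have hpow4 : (4 : ℝ) ^ L = (2 ^ L) ^ 2 := by
    rw [← pow_mul, mul_comm, pow_mul]; norm_num
  have huL : u ^ 2 ≤ 4 ^ L := by rw [hpow4]; gcongr
  have hlate : ∀ k, A ≤ k → √(2 ^ (∑ i, (k - a i)) / m) / 4 ^ k ≤ w / √(m / ρ) * β ^ k := by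
    intro k hk
    have e : β ^ k = w ^ k / 4 ^ k := by rw [hβ, div_pow]
    rw [e, ← mul_div_assoc]
    gcongr
    refine Real.sqrt_le_iff.2 ⟨by positivity, ?_⟩
    rw [mul_pow, div_pow, Real.sq_sqrt ht.le, hw2, ← pow_mul, mul_comm k 2, pow_mul, hw2,
      div_div_eq_mul_div, div_mul_eq_mul_div]
    gcongr
    exact hA k hk
  have hearly : ∀ k < A, √(2 ^ (∑ i, (k - a i)) / m) / 4 ^ k ≤ 2 ^ (d * A) / √m := by
    intro k hk
    rw [Real.sqrt_div (by positivity)]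
    have h1 : √((2 : ℝ) ^ (∑ i, (k - a i))) ≤ 2 ^ (d * A) := by
      refine Real.sqrt_le_iff.2 ⟨by positivity, ?_⟩
      rw [← pow_mul]
      refine pow_le_pow_right₀ (by norm_num) ?_
      calc ∑ i, (k - a i) ≤ ∑ _i : Fin d, A := Finset.sum_le_sum fun i _ => by omega
        _ = d * A := by simp
        _ ≤ d * A * 2 := by omega
    calc _ ≤ √((2 : ℝ) ^ (∑ i, (k - a i))) / √m / 1 := by
          gcongr; exact one_le_pow₀ (by norm_num)
      _ ≤ _ := by rw [div_one]; gcongr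
  have hgeom : ∑ k ∈ Finset.range (L + 1), β ^ k ≤ 3 * β ^ (L + 1) := by
    rw [geom_sum_eq (by linarith), div_le_iff₀ (by linarith)]
    have : (1 : ℝ) ≤ β ^ (L + 1) := one_le_pow₀ (by linarith)
    nlinarith
  have hβL : w / √(m / ρ) * (3 * β ^ (L + 1)) ≤ 3 * 4 ^ d / u ^ 2 := by
    -- This is 2^L ≤ 2u raised to the power d/2, with u^d = m/ρ.
    have e1 : w ^ L ≤ w * √(m / ρ) := by
      rw [← hum, hw, ← Real.sqrt_mul (by positivity), ← mul_pow]
      refine Real.le_sqrt_of_sq_le ?_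
      rw [← pow_mul, mul_comm, pow_mul, ← hw, hw2, ← pow_mul, mul_comm, pow_mul]
      gcongr
    have hst : 0 < √(m / ρ) := Real.sqrt_pos.2 ht
    have hβw : β ≤ w ^ 2 := by rw [hβ]; nlinarith
    have e2 : (4 : ℝ) ^ d = w ^ 2 * w ^ 2 := by rw [hw2, ← mul_pow]; norm_num
    calc w / √(m / ρ) * (3 * β ^ (L + 1)) = 3 * w * β * w ^ L / (√(m / ρ) * 4 ^ L) := by
          rw [pow_succ, hβ, div_pow]; field_simp
      _ ≤ 3 * w * w ^ 2 * (w * √(m / ρ)) / (√(m / ρ) * u ^ 2) := by gcongr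
      _ = 3 * 4 ^ d / u ^ 2 := by rw [e2]; field_simp
  refine ⟨L, ?_⟩
  have hsplit : ∀ k ∈ Finset.range (L + 1), √(2 ^ (∑ i, (k - a i)) / m) / 4 ^ k ≤
      w / √(m / ρ) * β ^ k + if k < A then 2 ^ (d * A) / √m else 0 := by
    intro k _
    have hnn : 0 ≤ w / √(m / ρ) * β ^ k := by positivity
    split_ifs with h
    · linarith [hearly k h]
    · linarith [hlate k (not_lt.1 h)]
  have hind : ∑ k ∈ Finset.range (L + 1), (if k < A then 2 ^ (d * A) / √m else 0) ≤
      A * (2 ^ (d * A) / √m) := by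
    rw [← Finset.sum_filter, Finset.sum_const, nsmul_eq_mul]
    gcongr
    calc _ ≤ (Finset.range A).card := Finset.card_le_card fun k hk => by
          simp only [Finset.mem_filter, Finset.mem_range] at hk ⊢; exact hk.2
      _ = A := Finset.card_range A
  rw [scaleSum]
  calc _ ≤ 1 / u ^ 2 + ∑ k ∈ Finset.range (L + 1),
        (w / √(m / ρ) * β ^ k + if k < A then 2 ^ (d * A) / √m else 0) := by
        gcongr with k hk
        exact hsplit k hk
    _ ≤ 1 / u ^ 2 + (3 * 4 ^ d / u ^ 2 + A * (2 ^ (d * A) / √m)) := by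
        rw [Finset.sum_add_distrib, ← Finset.mul_sum]
        gcongr
        refine le_trans ?_ hβL
        gcongr
    _ = _ := by ring

theorem heterogeneity_pos [NeZero d] {σ : Fin d → ℝ} (hσ : ∀ i, 0 < σ i) : 0 < heterogeneity σ :=
  Finset.prod_pos fun i _ => div_pos (hσ i) (hσ 0)

theorem heterogeneity_le_one [NeZero d] {σ : Fin d → ℝ} (hanti : Antitone σ)
    (hσ : ∀ i, 0 < σ i) : heterogeneity σ ≤ 1 :=
  Finset.prod_le_one (fun i _ => (div_pos (hσ i) (hσ 0)).le) fun i _ =>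
    (div_le_one (hσ 0)).2 (hanti (Fin.zero_le i))

/-- The delay aᵢ is the integer part of log₂(σ₁/σᵢ), so 2^(-aᵢ) < 2σᵢ/σ₁; multiplying over i gives
2^d times the heterogeneity. The condition ∑ aᵢ ≤ k serves to make every aᵢ ≤ k, so that no
subtraction k - aᵢ is truncated. -/
theorem exists_halving_delays [NeZero d] {σ : Fin d → ℝ} (hanti : Antitone σ)
    (hσ : ∀ i, 0 < σ i) :
    ∃ a : Fin d → ℕ, (∀ i, σ i * 2 ^ a i ≤ σ 0) ∧ ∀ k, ∑ i, a i ≤ k →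
      (2 : ℝ) ^ (∑ i, (k - a i)) ≤ 2 ^ d * heterogeneity σ * (2 ^ d) ^ k := by
  have h : ∀ i, ∃ n : ℕ, (2 : ℝ) ^ n ≤ σ 0 / σ i ∧ σ 0 / σ i < 2 ^ (n + 1) := fun i =>
    exists_nat_pow_near ((one_le_div (hσ i)).2 (hanti (Fin.zero_le i))) (by norm_num)
  choose a ha1 ha2 using h
  refine ⟨a, fun i => ?_, fun k hk => ?_⟩
  · have := (le_div_iff₀ (hσ i)).1 (ha1 i); linarith
  · have hai : ∀ i, a i ≤ k := fun i =>
      (Finset.single_le_sum (fun _ _ => Nat.zero_le _) (Finset.mem_univ i)).trans hk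
    have e : (2 : ℝ) ^ d * heterogeneity σ * (2 ^ d) ^ k = ∏ i, 2 * (σ i / σ 0) * 2 ^ k := by
      rw [Finset.prod_mul_distrib, Finset.prod_mul_distrib, heterogeneity]
      simp only [Finset.prod_const, Finset.card_univ, Fintype.card_fin]
      rw [← pow_mul, ← pow_mul, mul_comm k d]
    rw [e, ← Finset.prod_pow_eq_pow_sum]
    refine Finset.prod_le_prod (fun i _ => by positivity) fun i _ => ?_
    have h2 := ha2 i
    have hi := hσ i
    have h0 := hσ 0
    rw [div_lt_iff₀ hi, pow_succ] at h2
    have hk2 : (2 : ℝ) ^ k = 2 ^ (k - a i) * 2 ^ a i := by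
      rw [← pow_add, Nat.sub_add_cancel (hai i)]
    have hp : (0 : ℝ) < 2 ^ (k - a i) := by positivity
    calc (2 : ℝ) ^ (k - a i) = 2 ^ (k - a i) * (σ 0 / σ 0) := by rw [div_self h0.ne', mul_one]
      _ ≤ 2 ^ (k - a i) * ((2 ^ a i * 2 * σ i) / σ 0) := by gcongr
      _ = _ := by rw [hk2]; ring

theorem rpow_neg_inv_eq_inv {d : ℕ} (hd : d ≠ 0) {t : ℝ} (ht : 0 ≤ t) :
    ((t ^ (1 / d : ℝ)) ^ d = t) ∧ t ^ (-(1 / d) : ℝ) = (t ^ (1 / d : ℝ))⁻¹ := by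
  refine ⟨?_, Real.rpow_neg ht _⟩
  rw [one_div, Real.rpow_inv_natCast_pow ht hd]

theorem rateWith_eq_of_le (hd : d ≤ 4) (r : ℝ) (m : ℕ) :
    rateWith d r m = 2 * (m : ℝ) ^ (-(1 / 4) : ℝ) * Real.log (1 + m) ^ (1 / 2 : ℝ) := if_pos hd

theorem rateWith_eq_of_lt (hd : 4 < d) (r : ℝ) (m : ℕ) :
    rateWith d r m = 2 * ((m : ℝ) ^ (-(1 / 4) : ℝ) + (r * m) ^ (-(1 / d) : ℝ)) :=
  if_neg (not_le.2 hd)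

theorem sqrt_scale_le_rateWith_of_le (hd : d ≤ 4) (r : ℝ) {m : ℕ} (hm : 1 ≤ m) :
    √(scaleConst d * scaleSum (fun _ : Fin d => 0) (Nat.log 2 m) m) ≤
      √(12 * scaleConst d) * rateWith d r m := by
  have hm' : (1 : ℝ) ≤ m := by exact_mod_cast hm
  have hl : 0 ≤ Real.log (1 + m) := Real.log_nonneg (by linarith)
  have hc := scaleConst_nonneg d
  calc _ ≤ √(12 * scaleConst d * (Real.log (1 + m) / √m)) := by
        refine Real.sqrt_le_sqrt ?_
        have := mul_le_mul_of_nonneg_left (scaleSum_le_log hd hm) hc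
        linarith
    _ = √(12 * scaleConst d) * ((m : ℝ) ^ (-(1 / 4) : ℝ) * Real.log (1 + m) ^ (1 / 2 : ℝ)) := by
        rw [Real.sqrt_mul (by positivity), Real.sqrt_div hl, ← Real.sqrt_eq_rpow]
        congr 1
        rw [div_eq_inv_mul]
        congr 1
        rw [Real.rpow_neg (by linarith), Real.sqrt_eq_rpow, Real.sqrt_eq_rpow,
          ← Real.rpow_mul (by linarith)]
        norm_num
    _ ≤ _ := by
        rw [rateWith_eq_of_le hd]
        have : 0 ≤ (m : ℝ) ^ (-(1 / 4) : ℝ) * Real.log (1 + m) ^ (1 / 2 : ℝ) := by positivity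
        refine mul_le_mul_of_nonneg_left ?_ (Real.sqrt_nonneg _)
        linarith

/-- Here u = (m/ρ)^(1/d). The last hypothesis says that the early levels cost at most u^(-2), so
they are absorbed into the main term, turning 1 + 3 · 4^d into 2 + 3 · 4^d. -/
theorem sqrt_scale_le_of_lt (hd : 4 < d) (a : Fin d → ℕ) {A m : ℕ} {ρ : ℝ} (hρ : 0 < ρ)
    (hρ1 : ρ ≤ 1) (hm : 1 ≤ m)
    (hA : ∀ k, A ≤ k → (2 : ℝ) ^ (∑ i, (k - a i)) ≤ 2 ^ d * ρ * (2 ^ d) ^ k)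
    (hmA : A * 2 ^ (d * A) ≤ √(m : ℝ) * ((ρ⁻¹ * m) ^ (-(1 / d) : ℝ)) ^ 2) :
    ∃ L, √(scaleConst d * scaleSum a L m) ≤
      √(scaleConst d * (2 + 3 * 4 ^ d)) * (ρ⁻¹ * m) ^ (-(1 / d) : ℝ) := by
  have hm' : (1 : ℝ) ≤ m := by exact_mod_cast hm
  have ht : 1 ≤ ρ⁻¹ * m := one_le_mul_of_one_le_of_one_le (one_le_inv_iff₀.2 ⟨hρ, hρ1⟩) hm'
  obtain ⟨h1, h2⟩ := rpow_neg_inv_eq_inv (by omega : d ≠ 0) (by linarith : 0 ≤ ρ⁻¹ * m)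
  set u := (ρ⁻¹ * m) ^ (1 / d : ℝ) with hu
  have hu1 : 1 ≤ u := Real.one_le_rpow ht (by positivity)
  obtain ⟨L, hL⟩ := scaleSum_le_of_eventually_le hd a hρ (by linarith : (0 : ℝ) < m) hu1
    (by rw [h1]; ring) hA
  refine ⟨L, ?_⟩
  rw [h2] at hmA ⊢
  have hs : 0 < √(m : ℝ) := Real.sqrt_pos.2 (by linarith)
  have hc := scaleConst_nonneg d
  have h3 : scaleSum a L m ≤ (2 + 3 * 4 ^ d) * (u⁻¹) ^ 2 := by
    have : A * 2 ^ (d * A) / √(m : ℝ) ≤ u⁻¹ ^ 2 := by rw [div_le_iff₀ hs]; linarith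
    calc _ ≤ _ := hL
      _ ≤ (1 + 3 * 4 ^ d) / u ^ 2 + u⁻¹ ^ 2 := by gcongr
      _ = _ := by rw [inv_pow]; ring
  calc _ ≤ √(scaleConst d * (2 + 3 * 4 ^ d) * u⁻¹ ^ 2) := by
        refine Real.sqrt_le_sqrt ?_
        have := mul_le_mul_of_nonneg_left h3 hc
        linarith
    _ = _ := by rw [Real.sqrt_mul (by positivity), Real.sqrt_sq (by positivity)]

/-- The right-hand side is a positive constant times m^(1/2 - 2/d), and the exponent is positive
because d > 4. This is the origin of m₀. -/
theorem exists_forall_le_sqrt_mul_rpow (hd : 4 < d) {ρ : ℝ} (hρ : 0 < ρ) (B : ℝ) :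
    ∃ m₀ : ℕ, ∀ m : ℕ, m₀ ≤ m → B ≤ √(m : ℝ) * ((ρ⁻¹ * m) ^ (-(1 / d) : ℝ)) ^ 2 := by
  have hd' : (4 : ℝ) < d := by exact_mod_cast hd
  have hexp : (0 : ℝ) < 1 / 2 - 2 / d := by
    rw [sub_pos, div_lt_div_iff₀ (by linarith) (by norm_num)]; linarith
  have hr : 0 < (ρ⁻¹) ^ (-(2 / d) : ℝ) := by positivity
  have ht : Filter.Tendsto (fun m : ℕ => (ρ⁻¹) ^ (-(2 / d) : ℝ) * (m : ℝ) ^ (1 / 2 - 2 / d : ℝ))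
      Filter.atTop Filter.atTop :=
    ((tendsto_rpow_atTop hexp).comp tendsto_natCast_atTop_atTop).const_mul_atTop hr
  obtain ⟨m₀, h⟩ := Filter.eventually_atTop.1 (ht.eventually_ge_atTop B)
  refine ⟨max m₀ 1, fun m hm => (h m ((le_max_left _ _).trans hm)).trans_eq ?_⟩
  have hm1 : (0 : ℝ) < m := by exact_mod_cast (le_max_right m₀ 1).trans hm
  rw [← Real.rpow_natCast, ← Real.rpow_mul (by positivity), Real.mul_rpow (by positivity) hm1.le,
    Real.sqrt_eq_rpow, mul_left_comm, ← Real.rpow_add hm1]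
  congr 2 <;> push_cast <;> ring

/-- A suitable choice of the scales turns the multiscale estimate into the two rates. -/
theorem exists_scales (d : ℕ) [NeZero d] : ∃ C : ℝ, 0 < C ∧ ∀ σ : Fin d → ℝ, Antitone σ →
    (∀ i, 0 < σ i) → ∃ m₀ : ℕ, ∀ h : ℕ → ℝ, h = rate σ ∨ h = improvedRate σ m₀ →
      ∀ m : ℕ, 1 ≤ m → ∃ (τ : Fin d → ℝ) (a : Fin d → ℕ) (L : ℕ), (∀ i, σ i ≤ τ i) ∧
        (∀ i, τ i * 2 ^ a i ≤ σ 0) ∧ √(scaleConst d * scaleSum a L m) ≤ C * h m := by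
  have hc := scaleConst_nonneg d
  set C := √(12 * scaleConst d) + √(scaleConst d * (2 + 3 * 4 ^ d)) + 1 with hC
  have hC1 : √(12 * scaleConst d) ≤ C := by
    have := Real.sqrt_nonneg (scaleConst d * (2 + 3 * 4 ^ d)); linarith
  have hC2 : √(scaleConst d * (2 + 3 * 4 ^ d)) ≤ C := by
    have := Real.sqrt_nonneg (12 * scaleConst d); linarith
  refine ⟨C, by positivity, fun σ hanti hσ => ?_⟩
  have hr := heterogeneity_pos hσ
  have hr1 := heterogeneity_le_one hanti hσ
  have hrate : ∀ m : ℕ, 1 ≤ m → ∃ (τ : Fin d → ℝ) (a : Fin d → ℕ) (L : ℕ), (∀ i, σ i ≤ τ i) ∧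
      (∀ i, τ i * 2 ^ a i ≤ σ 0) ∧ √(scaleConst d * scaleSum a L m) ≤ C * rate σ m := by
    intro m hm
    have hm' : (1 : ℝ) ≤ m := by exact_mod_cast hm
    have hσ0 : ∀ i, σ i ≤ σ 0 := fun i => hanti (Fin.zero_le i)
    rcases le_or_gt d 4 with hd | hd
    -- Isotropic scales: every σᵢ is enlarged to the largest one and nothing is delayed.
    · refine ⟨fun _ => σ 0, fun _ => 0, Nat.log 2 m, hσ0, by simp, ?_⟩
      refine (sqrt_scale_le_rateWith_of_le hd (heterogeneity σ) hm).trans ?_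
      have hl : 0 ≤ Real.log (1 + m) := Real.log_nonneg (by linarith)
      have : 0 ≤ rateWith d (heterogeneity σ) m := by rw [rateWith_eq_of_le hd]; positivity
      exact mul_le_mul_of_nonneg_right hC1 this
    -- Isotropic scales again, with ρ = 1 and A = 0, so there are no early levels to absorb and
    -- every m ≥ 1 is admissible.
    · obtain ⟨L, hL⟩ := sqrt_scale_le_of_lt hd (fun _ => 0) (A := 0) one_pos le_rfl hm
        (fun k _ => by
          simp only [tsub_zero, Finset.sum_const, Finset.card_univ, Fintype.card_fin, smul_eq_mul,
            mul_one, pow_mul]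
          exact le_mul_of_one_le_left (by positivity) (one_le_pow₀ (by norm_num)))
        (by simp only [Nat.cast_zero, zero_mul]; positivity)
      refine ⟨fun _ => σ 0, fun _ => 0, L, hσ0, by simp, hL.trans ?_⟩
      rw [rate, rateWith_eq_of_lt hd, inv_one, one_mul]
      -- The heterogeneity is at most 1, so as a factor of m under a negative power it only enlarges
      -- the rate.
      have h1 : (m : ℝ) ^ (-(1 / d) : ℝ) ≤ (heterogeneity σ * m) ^ (-(1 / d) : ℝ) :=
        Real.rpow_le_rpow_of_nonpos (by positivity) (mul_le_of_le_one_left (by linarith) hr1)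
          (neg_nonpos.2 (by positivity))
      have h2 : 0 ≤ (m : ℝ) ^ (-(1 / 4) : ℝ) := by positivity
      have h3 : 0 ≤ (m : ℝ) ^ (-(1 / d) : ℝ) := by positivity
      gcongr
      linarith
  rcases le_or_gt d 4 with hd | hd
  -- For d ≤ 4 the heterogeneity does not enter the rate, so both rates coincide and any m₀ will do.
  · refine ⟨0, fun h hh m hm => ?_⟩
    have : h = rate σ := by
      rcases hh with rfl | rfl
      · rfl
      · ext m
        rw [improvedRate, if_pos (Nat.zero_le m), rate, rateWith_eq_of_le hd, rateWith_eq_of_le hd]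
    rw [this]
    exact hrate m hm
  · obtain ⟨a, ha, hA⟩ := exists_halving_delays hanti hσ
    -- m₀ is the size from which the early levels k < ∑ aᵢ are negligible; it depends on d and σ
    -- only.
    obtain ⟨m₀, hm₀⟩ := exists_forall_le_sqrt_mul_rpow hd hr
      ((∑ i, a i : ℕ) * 2 ^ (d * ∑ i, a i))
    refine ⟨m₀, fun h hh m hm => ?_⟩
    rcases hh with rfl | rfl
    · exact hrate m hm
    by_cases hmm : m₀ ≤ m
    · obtain ⟨L, hL⟩ := sqrt_scale_le_of_lt hd a hr hr1 hm hA (hm₀ m hmm)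
      refine ⟨σ, a, L, fun i => le_rfl, ha, hL.trans ?_⟩
      rw [improvedRate, if_pos hmm, rateWith_eq_of_lt hd]
      have hm' : (1 : ℝ) ≤ m := by exact_mod_cast hm
      have h2 : 0 ≤ (m : ℝ) ^ (-(1 / 4) : ℝ) := by positivity
      have h3 : 0 ≤ ((heterogeneity σ)⁻¹ * m) ^ (-(1 / d) : ℝ) := by positivity
      gcongr
      linarith
    · rw [improvedRate, if_neg hmm]
      exact hrate m hm

end Rates

end RandomField

/-! ### Sampling: measurability, the local comparison, Monte Carlo integration. -/

namespace RandomField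

section Sampling

variable {n d N : ℕ}

theorem self_mem_neighbors (X : Fin N → Vec n) {δ : ℝ} (hδ : 0 < δ) (i : Fin N) :
    i ∈ neighbors X δ (X i) := by
  simp [neighbors, hδ.le]

theorem ae_avg {E : Type*} [MeasurableSpace E] {s : Finset (Fin N)} {μ : Fin N → Measure E}
    {p : E → Prop} (h : ∀ j ∈ s, ∀ᵐ y ∂(μ j), p y) : ∀ᵐ y ∂(avg s μ), p y := by
  rw [ae_iff, avg_apply, Finset.sum_eq_zero fun j hj => ae_iff.1 (h j hj), mul_zero]

theorem isProbabilityMeasure_law {S : Type*} [MeasurableSpace S] (P : Measure S)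
    [IsProbabilityMeasure P] {f : Vec n → S → Vec d} (hf : Measurable (Function.uncurry f))
    (x : Vec n) : IsProbabilityMeasure (law P f x) :=
  Measure.isProbabilityMeasure_map (hf.comp measurable_prodMk_left).aemeasurable

theorem ae_law {S : Type*} [MeasurableSpace S] {P : Measure S}
    {f : Vec n → S → Vec d} (hf : Measurable (Function.uncurry f)) {x : Vec n} {M : ℝ}
    (h : ∀ᵐ w ∂P, ‖f x w‖ ^ 2 ≤ M) : ∀ᵐ y ∂(law P f x), ‖y‖ ^ 2 ≤ M :=
  (ae_map_iff (hf.comp measurable_prodMk_left).aemeasurable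
    (measurableSet_le (by fun_prop) measurable_const)).2 h

theorem measurable_law {S : Type*} [MeasurableSpace S] (P : Measure S) [IsProbabilityMeasure P]
    {f : Vec n → S → Vec d} (hf : Measurable (Function.uncurry f)) : Measurable (law P f) := by
  refine Measure.measurable_of_measurable_coe _ fun A hA => ?_
  have : ∀ x, law P f x A = P (Prod.mk x ⁻¹' (Function.uncurry f ⁻¹' A)) := fun x =>
    Measure.map_apply (hf.comp measurable_prodMk_left) hA
  simp only [this]
  exact measurable_measure_prodMk_left (hf hA)

/-- Boundedness makes the sixth power integrable, so the Bochner integral in `coordMoment` is the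
true moment and not the default value 0. -/
theorem lintegral_coord_pow_le {μ : Measure (Vec d)} [IsProbabilityMeasure μ] {M : ℝ}
    (hμ : ∀ᵐ y ∂μ, ‖y‖ ^ 2 ≤ M) {i : Fin d} {r : ℝ} (h : coordMoment μ i ≤ r) :
    ∫⁻ y, ‖y i‖ₑ ^ 6 ∂μ ≤ ENNReal.ofReal (r ^ 6) := by
  have hint : Integrable (fun y : Vec d => (y i) ^ 6) μ := by
    refine Integrable.of_bound (by fun_prop) (M ^ 3) ?_
    filter_upwards [hμ] with y hy
    rw [norm_pow, show ‖y i‖ ^ 6 = (‖y i‖ ^ 2) ^ 3 by ring]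
    have : ‖y i‖ ≤ ‖y‖ := PiLp.norm_apply_le y i
    have : ‖y i‖ ^ 2 ≤ M := le_trans (by gcongr) hy
    gcongr
  have h0 : 0 ≤ ∫ y, (y i) ^ 6 ∂μ := integral_nonneg fun y => by positivity
  have e : ∫⁻ y, ‖y i‖ₑ ^ 6 ∂μ = ENNReal.ofReal (∫ y, (y i) ^ 6 ∂μ) := by
    rw [ofReal_integral_eq_lintegral_ofReal hint
      (Filter.Eventually.of_forall fun y => by positivity)]
    refine lintegral_congr fun y => ?_
    rw [← ofReal_norm, ← ENNReal.ofReal_pow (norm_nonneg _), Real.norm_eq_abs,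
      Even.pow_abs (by decide)]
  rw [e]
  refine ENNReal.ofReal_le_ofReal ?_
  have h2 := pow_le_pow_left₀ (by unfold coordMoment; positivity) h 6
  rwa [coordMoment, ← Real.rpow_natCast, ← Real.rpow_mul h0,
    show (1 / 6 : ℝ) * ((6 : ℕ) : ℝ) = 1 by norm_num, Real.rpow_one] at h2

/-- The neighbourhood takes finitely many values, each on a measurable event given by the pairwise
distances; on each event the function is one of the measurable `Ψ s`. -/
theorem measurable_comp_neighbors {T β : Type*} [MeasurableSpace T] [MeasurableSpace β]
    {Ψ : Finset (Fin N) → T → β} (hΨ : ∀ s, Measurable (Ψ s)) {g : T → Fin N → Vec n}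
    (hg : Measurable g) (δ : ℝ) (i : Fin N) :
    Measurable fun t => Ψ (neighbors (g t) δ (g t i)) t := by
  let m : MeasurableSpace (Finset (Fin N)) := ⊤
  have hd : DiscreteMeasurableSpace (Finset (Fin N)) := ⟨fun _ => trivial⟩
  have hs : Measurable fun t => neighbors (g t) δ (g t i) := by
    refine measurable_to_countable' fun s => ?_
    have e : (fun t => neighbors (g t) δ (g t i)) ⁻¹' {s} =
        ⋂ j, {t | ‖g t j - g t i‖ ≤ δ ↔ j ∈ s} := by
      ext t
      simp [Finset.ext_iff, neighbors]
    rw [e]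
    refine MeasurableSet.iInter fun j => ?_
    have hm : MeasurableSet {t | ‖g t j - g t i‖ ≤ δ} :=
      measurableSet_le (by fun_prop) measurable_const
    by_cases hj : j ∈ s
    · simpa [hj] using hm
    · have hm' : MeasurableSet {t | δ < ‖g t j - g t i‖} :=
        measurableSet_lt measurable_const (by fun_prop)
      simpa [hj] using hm'
  exact (measurable_from_prod_countable_right (f := fun p : Finset (Fin N) × T => Ψ p.1 p.2)
    hΨ).comp (hs.prodMk measurable_id)

theorem setIntegral_inputMeasure {D : Set (Vec n)} {X : Fin N → Vec n} (hX : ∀ i, X i ∈ D)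
    (F : Vec n → ℝ) :
    ∫ x in D, F x ∂(inputMeasure X) = (N : ℝ)⁻¹ * ∑ i, F (X i) := by
  have hae : ∀ᵐ x ∂(inputMeasure X), x ∈ D := by
    rw [inputMeasure, empirical_eq_avg]
    refine ae_avg fun j _ => ?_
    rw [ae_dirac_eq]
    exact hX j
  rw [Measure.restrict_eq_self_of_ae_mem hae, inputMeasure, empirical, integral_smul_measure,
    integral_finsetSum_measure fun i _ => integrable_dirac (by simp)]
  simp

/-- By the triangle inequality the distance is 2-Lipschitz in the points, which is what makes the
local loss measurable. For empty `s` there is no coupling, and `W2` is constantly ∞. -/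
theorem continuous_W2_empirical {s : Finset (Fin N)} :
    Continuous fun p : (Fin N → Vec d) × (Fin N → Vec d) =>
      W2 (empirical s p.1) (empirical s p.2) := by
  rcases s.eq_empty_or_nonempty with rfl | hs
  · simp only [empirical, Finset.sum_empty]
    exact continuous_const
  refine continuous_of_le_add_edist 2 (by norm_num) fun p q => ?_
  have h1 : W2 (empirical s p.1) (empirical s q.1) ≤ edist p q :=
    W2_empirical_le hs fun j _ => by
      rw [← edist_eq_enorm_sub]
      exact (edist_le_pi_edist p.1 q.1 j).trans (le_max_left _ _)
  have h2 : W2 (empirical s q.2) (empirical s p.2) ≤ edist p q := by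
    rw [W2_comm]
    refine W2_empirical_le hs fun j _ => ?_
    rw [← edist_eq_enorm_sub]
    exact (edist_le_pi_edist p.2 q.2 j).trans (le_max_right _ _)
  calc W2 (empirical s p.1) (empirical s p.2)
      ≤ W2 (empirical s p.1) (empirical s q.1) + (W2 (empirical s q.1) (empirical s q.2) +
          W2 (empirical s q.2) (empirical s p.2)) :=
        (W2_triangle _ _ _).trans (add_le_add le_rfl (W2_triangle _ _ _))
    _ ≤ edist p q + (W2 (empirical s q.1) (empirical s q.2) + edist p q) := by gcongr
    _ = _ := by rw [two_mul]; ring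

theorem sqW2_nonneg (μ ν : Measure (Vec d)) : 0 ≤ sqW2 μ ν := sq_nonneg _

theorem sqW2_le {μ ν : Measure (Vec d)} [IsProbabilityMeasure μ] [IsProbabilityMeasure ν] {M : ℝ}
    (hM : 0 ≤ M) (hμ : ∀ᵐ y ∂μ, ‖y‖ ^ 2 ≤ M) (hν : ∀ᵐ y ∂ν, ‖y‖ ^ 2 ≤ M) :
    sqW2 μ ν ≤ 4 * M := by
  have h := ENNReal.toReal_le_of_le_ofReal (by positivity) (W2_le_of_ae_norm_le hμ hν)
  calc sqW2 μ ν ≤ (2 * √M) ^ 2 := pow_le_pow_left₀ ENNReal.toReal_nonneg h 2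
    _ = 4 * M := by rw [mul_pow, Real.sq_sqrt hM]; norm_num

/-- The Lipschitz assumptions make x ↦ W₂(μ_x, μ'_x) continuous on D. -/
theorem aemeasurable_sqW2 {D : Set (Vec n)} (hD : MeasurableSet D) {ν : Measure (Vec n)}
    (hν : ∀ᵐ x ∂ν, x ∈ D) {μ μ' : Vec n → Measure (Vec d)} {L : ℝ}
    (h : ∀ x ∈ D, ∀ z ∈ D, W2 (μ x) (μ z) ≤ ENNReal.ofReal (L * ‖x - z‖))
    (h' : ∀ x ∈ D, ∀ z ∈ D, W2 (μ' x) (μ' z) ≤ ENNReal.ofReal (L * ‖x - z‖)) :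
    AEMeasurable (fun x => sqW2 (μ x) (μ' x)) ν := by
  rw [← Measure.restrict_eq_self_of_ae_mem hν]
  refine aemeasurable_restrict_of_measurable_subtype hD ?_
  have hc : Continuous fun x : D => W2 (μ x) (μ' x) := by
    refine continuous_of_le_add_edist (2 * ENNReal.ofReal L)
      (ENNReal.mul_ne_top (by norm_num) ENNReal.ofReal_ne_top) fun x z => ?_
    have e : ∀ x z : D, ENNReal.ofReal (L * ‖(x : Vec n) - z‖) ≤ ENNReal.ofReal L * edist x z := by
      intro x z
      rw [ENNReal.ofReal_mul' (norm_nonneg _), ofReal_norm, ← edist_eq_enorm_sub]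
      rfl
    have h1 := (h x x.2 z z.2).trans (e x z)
    have h2 := (h' z z.2 x x.2).trans (e z x)
    rw [edist_comm] at h2
    calc W2 (μ x) (μ' x) ≤ W2 (μ x) (μ z) + (W2 (μ z) (μ' z) + W2 (μ' z) (μ' x)) :=
          (W2_triangle _ _ _).trans (add_le_add le_rfl (W2_triangle _ _ _))
      _ ≤ ENNReal.ofReal L * edist x z + (W2 (μ z) (μ' z) + ENNReal.ofReal L * edist x z) := by
          gcongr
      _ = _ := by ring
  exact hc.measurable.ennreal_toReal.pow_const 2

/-- The local comparison of the two squared distances at one sample point. -/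
theorem abs_sqW2_sub_sqW2_empirical_le {D : Set (Vec n)} {μ μ' : Vec n → Measure (Vec d)}
    [∀ x, IsProbabilityMeasure (μ x)] [∀ x, IsProbabilityMeasure (μ' x)] {M : ℝ}
    (hμ : ∀ x ∈ D, ∀ᵐ y ∂(μ x), ‖y‖ ^ 2 ≤ M) (hμ' : ∀ x ∈ D, ∀ᵐ y ∂(μ' x), ‖y‖ ^ 2 ≤ M)
    {L : ℝ} (hL : 0 ≤ L)
    (h : ∀ x ∈ D, ∀ z ∈ D, W2 (μ x) (μ z) ≤ ENNReal.ofReal (L * ‖x - z‖))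
    (h' : ∀ x ∈ D, ∀ z ∈ D, W2 (μ' x) (μ' z) ≤ ENNReal.ofReal (L * ‖x - z‖))
    {δ : ℝ} (hδ : 0 < δ) {X : Fin N → Vec n} (hX : ∀ i, X i ∈ D) {Y Y' : Fin N → Vec d}
    (hY : ∀ i, ‖Y i‖ ^ 2 ≤ M) (hY' : ∀ i, ‖Y' i‖ ^ 2 ≤ M) (i : Fin N) :
    |sqW2 (μ (X i)) (μ' (X i)) -
      sqW2 (empirical (neighbors X δ (X i)) Y) (empirical (neighbors X δ (X i)) Y')| ≤
    4 * √M * (2 * (L * δ) +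
      ((W2 (avg (neighbors X δ (X i)) fun j => μ (X j))
        (empirical (neighbors X δ (X i)) Y)).toReal +
      (W2 (avg (neighbors X δ (X i)) fun j => μ' (X j))
        (empirical (neighbors X δ (X i)) Y')).toReal)) := by
  set s := neighbors X δ (X i) with hs
  have hsne : s.Nonempty := ⟨i, self_mem_neighbors X hδ i⟩
  have hp : ∀ Z : Fin N → Vec d, IsProbabilityMeasure (empirical s Z) := fun Z =>
    isProbabilityMeasure_avg hsne _ fun j _ => inferInstance
  have hb : ∀ Z : Fin N → Vec d, (∀ i, ‖Z i‖ ^ 2 ≤ M) →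
      ∀ᵐ y ∂(empirical s Z), ‖y‖ ^ 2 ≤ M := fun Z hZ => by
    rw [empirical_eq_avg]
    refine ae_avg fun j _ => ?_
    rw [ae_dirac_eq]
    exact hZ j
  have key : ∀ (κ : Vec n → Measure (Vec d)) [∀ x, IsProbabilityMeasure (κ x)]
      (Z : Fin N → Vec d), (∀ x ∈ D, ∀ᵐ y ∂(κ x), ‖y‖ ^ 2 ≤ M) → (∀ i, ‖Z i‖ ^ 2 ≤ M) →
      (∀ x ∈ D, ∀ z ∈ D, W2 (κ x) (κ z) ≤ ENNReal.ofReal (L * ‖x - z‖)) →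
      W2 (κ (X i)) (empirical s Z) ≤ ENNReal.ofReal
        (L * δ + (W2 (avg s fun j => κ (X j)) (empirical s Z)).toReal) := by
    intro κ _ Z hκ hZ hκL
    have hpa : IsProbabilityMeasure (avg s fun j => κ (X j)) :=
      isProbabilityMeasure_avg hsne _ fun j _ => inferInstance
    have hfin : W2 (avg s fun j => κ (X j)) (empirical s Z) ≠ ∞ :=
      ne_top_of_le_ne_top ENNReal.ofReal_ne_top
        (W2_le_of_ae_norm_le (ae_avg fun j _ => hκ _ (hX j)) (hb Z hZ))
    have h1 : W2 (κ (X i)) (avg s fun j => κ (X j)) ≤ ENNReal.ofReal (L * δ) := by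
      -- The law at `X i` is regarded as an average of copies of itself, so that convexity compares
      -- it term by term with the laws at its neighbours.
      rw [← avg_const hsne (κ (X i))]
      refine W2_avg_le (c := (L * δ).toNNReal) hsne fun j hj => ?_
      refine (hκL _ (hX i) _ (hX j)).trans (ENNReal.ofReal_le_ofReal ?_)
      have : ‖X j - X i‖ ≤ δ := by simpa [hs, neighbors] using hj
      rw [norm_sub_rev]
      gcongr
    rw [ENNReal.ofReal_add (by positivity) ENNReal.toReal_nonneg, ENNReal.ofReal_toReal hfin]
    exact (W2_triangle _ _ _).trans (add_le_add h1 le_rfl)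
  have k1 := key μ Y hμ hY h
  have k2 := key μ' Y' hμ' hY' h'
  set e1 := (W2 (avg s fun j => μ (X j)) (empirical s Y)).toReal with he1
  set e2 := (W2 (avg s fun j => μ' (X j)) (empirical s Y')).toReal with he2
  have he1' : 0 ≤ e1 := ENNReal.toReal_nonneg
  have he2' : 0 ≤ e2 := ENNReal.toReal_nonneg
  have b1 := W2_le_of_ae_norm_le (hμ _ (hX i)) (hμ' _ (hX i))
  have b2 := W2_le_of_ae_norm_le (hb Y hY) (hb Y' hY')
  have t1 : W2 (μ (X i)) (μ' (X i)) ≤ ENNReal.ofReal (L * δ + e1) +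
      (W2 (empirical s Y) (empirical s Y') + ENNReal.ofReal (L * δ + e2)) := by
    refine (W2_triangle _ (empirical s Y) _).trans (add_le_add k1 ?_)
    refine (W2_triangle _ (empirical s Y') _).trans (add_le_add le_rfl ?_)
    rw [W2_comm]; exact k2
  have t2 : W2 (empirical s Y) (empirical s Y') ≤ ENNReal.ofReal (L * δ + e1) +
      (W2 (μ (X i)) (μ' (X i)) + ENNReal.ofReal (L * δ + e2)) := by
    refine (W2_triangle _ (μ (X i)) _).trans (add_le_add (by rw [W2_comm]; exact k1) ?_)
    exact (W2_triangle _ (μ' (X i)) _).trans (add_le_add le_rfl k2)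
  have f1 := ne_top_of_le_ne_top ENNReal.ofReal_ne_top b1
  have f2 := ne_top_of_le_ne_top ENNReal.ofReal_ne_top b2
  have r1 := ENNReal.toReal_le_of_le_ofReal (by positivity) b1
  have r2 := ENNReal.toReal_le_of_le_ofReal (by positivity) b2
  have c1 : 0 ≤ L * δ + e1 := by positivity
  have c2 : 0 ≤ L * δ + e2 := by positivity
  rw [← ENNReal.ofReal_toReal f1, ← ENNReal.ofReal_toReal f2,
    ← ENNReal.ofReal_add ENNReal.toReal_nonneg c2,
    ← ENNReal.ofReal_add c1 (add_nonneg ENNReal.toReal_nonneg c2),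
    ENNReal.ofReal_le_ofReal_iff (add_nonneg c1 (add_nonneg ENNReal.toReal_nonneg c2))] at t1 t2
  unfold sqW2
  set A := (W2 (μ (X i)) (μ' (X i))).toReal with hA
  set B := (W2 (empirical s Y) (empirical s Y')).toReal with hB
  have hA0 : 0 ≤ A := ENNReal.toReal_nonneg
  have hB0 : 0 ≤ B := ENNReal.toReal_nonneg
  have hd : |A - B| ≤ 2 * (L * δ) + (e1 + e2) := abs_le.2 ⟨by linarith, by linarith⟩
  -- Both distances are at most 2√M, hence the factor 4√M.
  calc |A ^ 2 - B ^ 2| = (A + B) * |A - B| := by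
        rw [sq_sub_sq, abs_mul, abs_of_nonneg (add_nonneg hA0 hB0)]
    _ ≤ (4 * √M) * (2 * (L * δ) + (e1 + e2)) := by
        gcongr
        linarith

/-- The N pairs are regrouped into a block of inputs and a block of latent variables, which are
independent; conditioning on the inputs becomes Fubini's theorem. -/
theorem IsIIDSample.hasLaw_fin {Ω S : Type*} [MeasurableSpace Ω] [MeasurableSpace S]
    {Pr : Measure Ω} [IsProbabilityMeasure Pr] {ν : Measure (Vec n)} [IsProbabilityMeasure ν]
    {P : Measure S} [IsProbabilityMeasure P] {X : ℕ → Ω → Vec n} {W : ℕ → Ω → S}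
    (h : IsIIDSample Pr ν P X W) (N : ℕ) :
    HasLaw (fun a => ((fun i : Fin N => X i a), fun i : Fin N => W i a))
      ((Measure.pi fun _ : Fin N => ν).prod (Measure.pi fun _ : Fin N => P)) Pr := by
  have hm : ∀ i, AEMeasurable (fun a => (X i a, W i a)) Pr := fun i => (h.hasLaw i).aemeasurable
  have hi : iIndepFun (fun (i : Fin N) a => (X i a, W i a)) Pr :=
    h.indep.precomp Fin.val_injective
  have hmap := (iIndepFun_iff_map_fun_eq_pi_map fun i : Fin N => hm i).1 hi
  simp only [(h.hasLaw _).map_eq] at hmap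
  have hmp := measurePreserving_arrowProdEquivProdArrow (Vec n) S (Fin N)
    (fun _ => ν) (fun _ => P)
  have hpm : AEMeasurable (fun a (i : Fin N) => (X i a, W i a)) Pr :=
    aemeasurable_pi_lambda _ fun i => hm i
  refine ⟨hmp.measurable.comp_aemeasurable hpm, ?_⟩
  rw [← hmp.map_eq, ← hmap, AEMeasurable.map_map_of_aemeasurable hmp.measurable.aemeasurable hpm]
  rfl

theorem IsIIDSample.aemeasurable_fst {Ω S : Type*} [MeasurableSpace Ω] [MeasurableSpace S]
    {Pr : Measure Ω} {ν : Measure (Vec n)} {P : Measure S} {X : ℕ → Ω → Vec n} {W : ℕ → Ω → S}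
    (h : IsIIDSample Pr ν P X W) (i : ℕ) : AEMeasurable (X i) Pr :=
  measurable_fst.comp_aemeasurable (h.hasLaw i).aemeasurable

theorem IsIIDSample.map_fst {Ω S : Type*} [MeasurableSpace Ω] [MeasurableSpace S]
    {Pr : Measure Ω} {ν : Measure (Vec n)} {P : Measure S} [IsProbabilityMeasure P]
    {X : ℕ → Ω → Vec n} {W : ℕ → Ω → S} (h : IsIIDSample Pr ν P X W) (i : ℕ) :
    Pr.map (X i) = ν := by
  have := congrArg (Measure.map Prod.fst) (h.hasLaw i).map_eq
  rw [AEMeasurable.map_map_of_aemeasurable measurable_fst.aemeasurable (h.hasLaw i).aemeasurable,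
    Measure.map_fst_prod, measure_univ, one_smul] at this
  exact this

theorem IsIIDSample.ae_mem {Ω S : Type*} [MeasurableSpace Ω] [MeasurableSpace S]
    {Pr : Measure Ω} {ν : Measure (Vec n)} {P : Measure S} [IsProbabilityMeasure P]
    {X : ℕ → Ω → Vec n} {W : ℕ → Ω → S} (h : IsIIDSample Pr ν P X W) {D : Set (Vec n)}
    (hν : ∀ᵐ x ∂ν, x ∈ D) (i : ℕ) : ∀ᵐ a ∂Pr, X i a ∈ D := by
  rw [← h.map_fst i] at hν
  exact ae_of_ae_map (h.aemeasurable_fst i) hν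

theorem IsIIDSample.ae_norm_le {Ω S : Type*} [MeasurableSpace Ω] [MeasurableSpace S]
    {Pr : Measure Ω} {ν : Measure (Vec n)} [SFinite ν] {P : Measure S} [SFinite P]
    {X : ℕ → Ω → Vec n} {W : ℕ → Ω → S} (h : IsIIDSample Pr ν P X W) {D : Set (Vec n)}
    (hν : ∀ᵐ x ∂ν, x ∈ D) {f : Vec n → S → Vec d} (hf : Measurable (Function.uncurry f)) {M : ℝ}
    (hM : ∀ x ∈ D, ∀ᵐ w ∂P, ‖f x w‖ ^ 2 ≤ M) (i : ℕ) : ∀ᵐ a ∂Pr, ‖f (X i a) (W i a)‖ ^ 2 ≤ M := by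
  have hset : MeasurableSet {p : Vec n × S | ‖f p.1 p.2‖ ^ 2 ≤ M} :=
    measurableSet_le (hf.norm.pow_const 2) measurable_const
  have : ∀ᵐ p ∂(ν.prod P), ‖f p.1 p.2‖ ^ 2 ≤ M :=
    (Measure.ae_prod_iff_ae_ae hset).2 (hν.mono hM)
  rw [← (h.hasLaw i).map_eq] at this
  exact ae_of_ae_map (h.hasLaw i).aemeasurable this

/-- The mean error of the Monte Carlo integration of a bounded function. -/
theorem IsIIDSample.lintegral_average_sub_integral_le {Ω S : Type*} [MeasurableSpace Ω]
    [MeasurableSpace S] {Pr : Measure Ω} [IsProbabilityMeasure Pr] {ν : Measure (Vec n)}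
    {P : Measure S} [IsProbabilityMeasure P]
    {X : ℕ → Ω → Vec n} {W : ℕ → Ω → S} (h : IsIIDSample Pr ν P X W) {F : Vec n → ℝ}
    (hF : AEMeasurable F ν) {B : ℝ} (hB : 0 ≤ B) (hFB : ∀ᵐ x ∂ν, |F x| ≤ B) {N : ℕ} (hN : 1 ≤ N) :
    ∫⁻ a, ‖(N : ℝ)⁻¹ * ∑ i : Fin N, F (X i a) - ∫ x, F x ∂ν‖ₑ ∂Pr ≤ ENNReal.ofReal (B / √N) := by
  have hN' : (0 : ℝ) < N := by exact_mod_cast hN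
  -- F is only almost everywhere measurable; a measurable version may replace it because each input
  -- has law ν.
  let G := hF.mk F
  have hG : Measurable G := hF.measurable_mk
  have hFG : F =ᵐ[ν] G := hF.ae_eq_mk
  have hXm := h.aemeasurable_fst
  have hFGX : ∀ᵐ a ∂Pr, ∀ i : Fin N, F (X i a) = G (X i a) := ae_all_iff.2 fun i =>
    ae_of_ae_map (hXm i) (by rw [h.map_fst i]; exact hFG)
  have hGB : ∀ᵐ x ∂ν, |G x| ≤ B := by
    filter_upwards [hFB, hFG] with x h1 h2
    rwa [← h2]
  have hGX : ∀ i, ∀ᵐ a ∂Pr, |G (X i a)| ≤ B := fun i =>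
    ae_of_ae_map (hXm i) (by rw [h.map_fst i]; exact hGB)
  have hmem : ∀ i, MemLp (fun a => G (X i a)) 2 Pr := fun i =>
    MemLp.of_bound (hG.comp_aemeasurable (hXm i)).aestronglyMeasurable B (hGX i)
  have hind : iIndepFun (fun (i : Fin N) a => G (X i a)) Pr :=
    (h.indep.precomp Fin.val_injective).comp (fun (_ : Fin N) p => G p.1)
      fun _ => hG.comp measurable_fst
  have hint : ∀ i, ∫ a, G (X i a) ∂Pr = ∫ x, F x ∂ν := fun i => by
    rw [integral_congr_ae hFG, ← h.map_fst i, integral_map (hXm i) hG.aestronglyMeasurable]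
  have hv := variance_average_le Pr Finset.univ (X := fun (i : Fin N) a => G (X i a))
    (fun i _ => hmem i) hind (v := fun _ => B ^ 2) (fun i _ => by
      calc ∫ a, G (X i a) ^ 2 ∂Pr ≤ ∫ _, B ^ 2 ∂Pr := by
            refine integral_mono_ae (hmem i).integrable_sq (integrable_const _) ?_
            filter_upwards [hGX i] with a ha
            exact sq_le_sq' (by linarith [abs_le.1 ha]) (abs_le.1 ha).2
        _ = B ^ 2 := by simp)
  have hmean : ∫ a, (N : ℝ)⁻¹ * ∑ i : Fin N, G (X i a) ∂Pr = ∫ x, F x ∂ν := by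
    rw [integral_const_mul, integral_finsetSum Finset.univ (f := fun (i : Fin N) a => G (X i a))
      fun i _ => (hmem i).integrable (by norm_num)]
    simp only [hint, Finset.sum_const, Finset.card_univ, Fintype.card_fin, nsmul_eq_mul]
    field_simp
  have hZ : MemLp (fun a => (N : ℝ)⁻¹ * ∑ i : Fin N, G (X i a)) 2 Pr :=
    (memLp_finsetSum Finset.univ fun (i : Fin N) _ => hmem i).const_mul _
  have key := lintegral_enorm_sub_integral_le Pr hZ
  rw [hmean] at key
  calc _ = ∫⁻ a, ‖(N : ℝ)⁻¹ * ∑ i : Fin N, G (X i a) - ∫ x, F x ∂ν‖ₑ ∂Pr := by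
        refine lintegral_congr_ae ?_
        filter_upwards [hFGX] with a ha
        simp only [ha]
    _ ≤ _ := key
    _ ≤ (ENNReal.ofReal (B ^ 2 / N)) ^ (1 / 2 : ℝ) := by
        refine ENNReal.rpow_le_rpow (ENNReal.ofReal_le_ofReal ?_) (by norm_num)
        rw [Finset.card_univ, Fintype.card_fin] at hv
        refine hv.trans_eq ?_
        rw [Finset.sum_const, Finset.card_univ, Fintype.card_fin, nsmul_eq_mul]
        field_simp
    _ = _ := by
        rw [ENNReal.ofReal_rpow_of_nonneg (by positivity) (by norm_num), ← Real.sqrt_eq_rpow,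
          Real.sqrt_div (sq_nonneg B), Real.sqrt_sq hB]

end Sampling

end RandomField

/-! ### The mean local error and the final estimate. -/

namespace RandomField

section Main

variable {n d N : ℕ}

/-- A sample point is its own neighbour, so the value of a rate at m = 0 never matters. -/
theorem nbrCount_self_pos (X : Fin N → Vec n) {δ : ℝ} (hδ : 0 < δ) (i : Fin N) :
    1 ≤ nbrCount X δ (X i) :=
  Finset.card_pos.2 ⟨i, self_mem_neighbors X hδ i⟩

theorem nbrCount_le (X : Fin N → Vec n) (δ : ℝ) (x : Vec n) : nbrCount X δ x ≤ N :=
  (Finset.card_le_univ _).trans_eq (Fintype.card_fin N)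

/-- The mean `W₂` distance of the empirical law of the outputs near `X i` from the averaged law,
through a measurable majorant. -/
theorem IsIIDSample.exists_majorant_W2_avg_empirical [NeZero d] {Ω S : Type*} [MeasurableSpace Ω]
    [MeasurableSpace S] {Pr : Measure Ω} [IsProbabilityMeasure Pr] {ν : Measure (Vec n)}
    [IsProbabilityMeasure ν] {P : Measure S} [IsProbabilityMeasure P] {X : ℕ → Ω → Vec n}
    {W : ℕ → Ω → S} (h : IsIIDSample Pr ν P X W) {D : Set (Vec n)} (hν : ∀ᵐ x ∂ν, x ∈ D)
    {f : Vec n → S → Vec d} (hf : Measurable (Function.uncurry f)) {σ : Fin d → ℝ}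
    (hσ : ∀ i, 0 < σ i)
    (hmom : ∀ x ∈ D, ∀ i, ∫⁻ y, ‖y i‖ₑ ^ 6 ∂(law P f x) ≤ ENNReal.ofReal (σ i ^ 6)) {C : ℝ}
    {H : ℕ → ℝ}
    (hH : ∀ m : ℕ, 1 ≤ m → ∃ (τ : Fin d → ℝ) (a : Fin d → ℕ) (L : ℕ), (∀ i, σ i ≤ τ i) ∧
      (∀ i, τ i * 2 ^ a i ≤ σ 0) ∧ √(scaleConst d * scaleSum a L m) ≤ C * H m)
    {δ : ℝ} (hδ : 0 < δ) (i : Fin N) :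
    ∃ V : Ω → ℝ≥0∞, AEMeasurable V Pr ∧
      (∀ a, W2 (avg (neighbors (fun j : Fin N => X j a) δ (X i a)) fun j => law P f (X j a))
        (empirical (neighbors (fun j : Fin N => X j a) δ (X i a))
          fun j => f (X j a) (W j a)) ≤ V a) ∧
      ∫⁻ a, V a ∂Pr ≤
        ∫⁻ a, ENNReal.ofReal (σ 0 * (C * H (nbrCount (fun j : Fin N => X j a) δ (X i a)))) ∂Pr := by
  choose! τ α L hτ hα hle using hH
  have hlaw := h.hasLaw_fin N
  have hkl := measurable_law P hf
  have hpl := isProbabilityMeasure_law P hf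
  -- The scales may depend on the number of neighbours, which is fixed once the set `s` of
  -- neighbours is.
  let Ψ : Finset (Fin N) → (Fin N → Vec n) × (Fin N → S) → ℝ≥0∞ := fun s p =>
    multiscale (τ s.card) (α s.card) (σ 0) (L s.card) (avg s fun j => law P f (p.1 j))
      (empirical s fun j => f (p.1 j) (p.2 j)) ^ (1 / 2 : ℝ)
  let U : (Fin N → Vec n) × (Fin N → S) → ℝ≥0∞ := fun p => Ψ (neighbors p.1 δ (p.1 i)) p
  have hΨ : ∀ s, Measurable (Ψ s) := by
    intro s
    refine Measurable.pow_const (measurable_multiscale _ _ _ _ ?_ ?_) _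
    · exact measurable_avg_of_measurable s fun j => hkl.comp (by fun_prop)
    · refine (measurable_empirical s).comp (measurable_pi_lambda _ fun j => ?_)
      exact hf.comp (by fun_prop : Measurable
        fun p : (Fin N → Vec n) × (Fin N → S) => (p.1 j, p.2 j))
  have hU : Measurable U := measurable_comp_neighbors hΨ measurable_fst δ i
  let R : (Fin N → Vec n) → ℝ≥0∞ := fun x =>
    ENNReal.ofReal (σ 0 * (C * H (nbrCount x δ (x i))))
  have hR : Measurable R :=
    measurable_comp_neighbors (Ψ := fun s _ => ENNReal.ofReal (σ 0 * (C * H s.card)))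
      (fun s => measurable_const) measurable_id δ i
  refine ⟨fun a => U (fun j : Fin N => X j a, fun j : Fin N => W j a),
    hU.comp_aemeasurable hlaw.aemeasurable, fun a => ?_, ?_⟩
  · have hne : (neighbors (fun j : Fin N => X j a) δ (X i a)).Nonempty :=
      ⟨i, self_mem_neighbors (fun j : Fin N => X j a) hδ i⟩
    have h1 := hne.card_pos
    have := isProbabilityMeasure_avg hne (fun j => law P f (X j a)) fun j _ => hpl _
    have : IsProbabilityMeasure (empirical (neighbors (fun j : Fin N => X j a) δ (X i a))
        fun j => f (X j a) (W j a)) := isProbabilityMeasure_avg hne _ fun j _ => inferInstance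
    exact W2_le_multiscale (fun k => (hσ k).trans_le (hτ _ h1 k)) (hα _ h1) _ _ _
  · have hD : ∀ᵐ x ∂(Measure.pi fun _ : Fin N => ν), ∀ j, x j ∈ D := ae_all_iff.2 fun j =>
      (Measure.tendsto_eval_ae_ae (μ := fun _ : Fin N => ν) (i := j)).eventually hν
    calc ∫⁻ a, U (fun j : Fin N => X j a, fun j : Fin N => W j a) ∂Pr
        = ∫⁻ p, U p ∂((Measure.pi fun _ : Fin N => ν).prod (Measure.pi fun _ : Fin N => P)) := by
          rw [← hlaw.map_eq, lintegral_map' hU.aemeasurable hlaw.aemeasurable]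
      _ = ∫⁻ x, ∫⁻ w, U (x, w) ∂(Measure.pi fun _ : Fin N => P)
            ∂(Measure.pi fun _ : Fin N => ν) := lintegral_prod _ hU.aemeasurable
      _ ≤ ∫⁻ x, R x ∂(Measure.pi fun _ : Fin N => ν) := by
          refine lintegral_mono_ae ?_
          filter_upwards [hD] with x hx
          set s := neighbors x δ (x i) with hs
          have hne : s.Nonempty := ⟨i, self_mem_neighbors x hδ i⟩
          have h1 : 1 ≤ s.card := hne.card_pos
          have hτ0 : ∀ k, 0 < τ s.card k := fun k => (hσ k).trans_le (hτ _ h1 k)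
          have hfx : ∀ j, Measurable (f (x j)) := fun j => hf.comp measurable_prodMk_left
          have key := lintegral_multiscale_rpow_half_le hτ0 (α s.card) (hσ 0).le (L s.card) hne
            (fun j => law P f (x j)) fun j k => (hmom _ (hx j) k).trans
              (ENNReal.ofReal_le_ofReal (pow_le_pow_left₀ (hσ k).le (hτ _ h1 k) 6))
          -- For fixed inputs the outputs are independent, the j-th one with the law at `x j`; this
          -- is the product measure of the multiscale estimate.
          have hpi : (Measure.pi fun _ : Fin N => P).map (fun w j => f (x j) (w j)) =
              Measure.pi fun j => law P f (x j) :=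
            Measure.pi_map_pi fun j => (hfx j).aemeasurable
          rw [← hpi, lintegral_map] at key
          · refine key.trans (ENNReal.ofReal_le_ofReal ?_)
            exact mul_le_mul_of_nonneg_left (hle _ h1) (hσ 0).le
          · exact (measurable_multiscale _ _ _ _ measurable_const
              (measurable_empirical s)).pow_const _
          · exact measurable_pi_lambda _ fun j => (hfx j).comp (measurable_pi_apply j)
      _ = ∫⁻ p, R p.1 ∂((Measure.pi fun _ : Fin N => ν).prod (Measure.pi fun _ : Fin N => P)) := by
          rw [lintegral_prod _ (by fun_prop)]; simp
      _ = ∫⁻ a, R (fun j : Fin N => X j a) ∂Pr := by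
          rw [← hlaw.map_eq, lintegral_map' (by fun_prop) hlaw.aemeasurable]

theorem integrable_comp_nbrCount {Ω : Type*} [MeasurableSpace Ω] {Pr : Measure Ω}
    [IsProbabilityMeasure Pr] {X : ℕ → Ω → Vec n} (hX : ∀ i, AEMeasurable (X i) Pr) (H : ℕ → ℝ)
    (δ : ℝ) (i : Fin N) :
    Integrable (fun a => H (nbrCount (fun j : Fin N => X j a) δ (X i a))) Pr := by
  have hm : Measurable fun x : Fin N → Vec n => H (nbrCount x δ (x i)) :=
    measurable_comp_neighbors (Ψ := fun s _ => H s.card) (fun s => measurable_const)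
      measurable_id δ i
  have hXm : AEMeasurable (fun a (j : Fin N) => X j a) Pr :=
    aemeasurable_pi_lambda _ fun j => hX j
  refine Integrable.of_bound (hm.comp_aemeasurable hXm).aestronglyMeasurable
    (∑ m ∈ Finset.range (N + 1), |H m|) (Filter.Eventually.of_forall fun a => ?_)
  exact Finset.single_le_sum (f := fun m => |H m|) (fun m _ => abs_nonneg _)
    (Finset.mem_range.2 (Nat.lt_succ_of_le (nbrCount_le _ δ _)))

theorem expectedRate_eq {Ω S : Type*} [MeasurableSpace Ω] [MeasurableSpace S] {Pr : Measure Ω}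
    [IsProbabilityMeasure Pr] {ν : Measure (Vec n)} {P : Measure S} [IsProbabilityMeasure P]
    {X : ℕ → Ω → Vec n} {W : ℕ → Ω → S} (h : IsIIDSample Pr ν P X W) {D : Set (Vec n)}
    (hν : ∀ᵐ x ∂ν, x ∈ D) (δ : ℝ) (N : ℕ) (H : ℕ → ℝ) :
    expectedRate Pr D X δ N H =
      (N : ℝ)⁻¹ * ∑ i : Fin N, ∫ a, H (nbrCount (fun j : Fin N => X j a) δ (X i a)) ∂Pr := by
  have hD : ∀ᵐ a ∂Pr, ∀ i : Fin N, X i a ∈ D := ae_all_iff.2 fun i => h.ae_mem hν i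
  rw [expectedRate, ← integral_finsetSum Finset.univ
    fun i _ => integrable_comp_nbrCount h.aemeasurable_fst H δ i, ← integral_const_mul]
  refine integral_congr_ae ?_
  filter_upwards [hD] with a ha
  exact setIntegral_inputMeasure (X := fun i : Fin N => X i a) ha _

/-- Valid for any rate H that some choice of scales attains. The constant 8CM₀ collects 4√M₀ from
the difference of squares, 2 from the two fields and C σ₁ ≤ C√M₀ from the mean distance. The errors
of the two fields are merely added in expectation, so the joint law of `W` and `W'` plays no role.
-/
theorem integrable_gap_and_integral_gap_le [NeZero d] {σ : Fin d → ℝ} (hσ : ∀ i, 0 < σ i) {C : ℝ}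
    (hC : 0 < C) {H : ℕ → ℝ}
    (hH : ∀ m : ℕ, 1 ≤ m → ∃ (τ : Fin d → ℝ) (a : Fin d → ℕ) (L : ℕ), (∀ i, σ i ≤ τ i) ∧
      (∀ i, τ i * 2 ^ a i ≤ σ 0) ∧ √(scaleConst d * scaleSum a L m) ≤ C * H m)
    {D : Set (Vec n)} (hDm : MeasurableSet D) {ν : Measure (Vec n)} [IsProbabilityMeasure ν]
    (hν : ∀ᵐ x ∂ν, x ∈ D) {S S' : Type*} [MeasurableSpace S] [MeasurableSpace S']
    {P : Measure S} [IsProbabilityMeasure P] {P' : Measure S'} [IsProbabilityMeasure P']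
    {f : Vec n → S → Vec d} {g : Vec n → S' → Vec d}
    (hf : Measurable (Function.uncurry f)) (hg : Measurable (Function.uncurry g)) {M₀ : ℝ}
    (hfM : ∀ x ∈ D, ∀ᵐ w ∂P, ‖f x w‖ ^ 2 ≤ M₀) (hgM : ∀ x ∈ D, ∀ᵐ w ∂P', ‖g x w‖ ^ 2 ≤ M₀)
    (hfσ : ∀ x ∈ D, ∀ i, coordMoment (law P f x) i ≤ σ i)
    (hgσ : ∀ x ∈ D, ∀ i, coordMoment (law P' g x) i ≤ σ i) (hσM : σ 0 ≤ √M₀)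
    {L : ℝ} (hL : 0 ≤ L)
    (hfL : ∀ x ∈ D, ∀ z ∈ D, W2 (law P f x) (law P f z) ≤ ENNReal.ofReal (L * ‖x - z‖))
    (hgL : ∀ x ∈ D, ∀ z ∈ D, W2 (law P' g x) (law P' g z) ≤ ENNReal.ofReal (L * ‖x - z‖))
    {Ω : Type*} [MeasurableSpace Ω] {Pr : Measure Ω} [IsProbabilityMeasure Pr]
    {X : ℕ → Ω → Vec n} {W : ℕ → Ω → S} {W' : ℕ → Ω → S'}
    (hX : IsIIDSample Pr ν P X W) (hX' : IsIIDSample Pr ν P' X W') {δ : ℝ} (hδ : 0 < δ)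
    {N : ℕ} (hN : 1 ≤ N) :
    Integrable (gap D ν P P' f g X W W' δ N) Pr ∧
      ∫ a, gap D ν P P' f g X W W' δ N a ∂Pr ≤
        4 * M₀ / √N + 8 * C * M₀ * expectedRate Pr D X δ N H + 8 * √M₀ * L * δ := by
  have hM : 0 < M₀ := Real.sqrt_pos.1 ((hσ 0).trans_le hσM)
  have hN' : (0 : ℝ) < N := by exact_mod_cast hN
  have hHnn : ∀ m, 1 ≤ m → 0 ≤ H m := fun m hm => by
    obtain ⟨_, _, _, _, _, h3⟩ := hH m hm
    exact nonneg_of_mul_nonneg_right ((Real.sqrt_nonneg _).trans h3) hC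
  have hpf := isProbabilityMeasure_law P hf
  have hpg := isProbabilityMeasure_law P' hg
  have hfb : ∀ x ∈ D, ∀ᵐ y ∂(law P f x), ‖y‖ ^ 2 ≤ M₀ := fun x hx => ae_law hf (hfM x hx)
  have hgb : ∀ x ∈ D, ∀ᵐ y ∂(law P' g x), ‖y‖ ^ 2 ≤ M₀ := fun x hx => ae_law hg (hgM x hx)
  choose V hVm hVle hVint using fun i : Fin N => hX.exists_majorant_W2_avg_empirical hν hf hσ
    (fun x hx k => lintegral_coord_pow_le (hfb x hx) (hfσ x hx k)) hH hδ i
  choose V' hVm' hVle' hVint' using fun i : Fin N => hX'.exists_majorant_W2_avg_empirical hν hg hσ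
    (fun x hx k => lintegral_coord_pow_le (hgb x hx) (hgσ x hx k)) hH hδ i
  set F : Vec n → ℝ := fun x => sqW2 (law P f x) (law P' g x) with hFdef
  have hF : AEMeasurable F ν := aemeasurable_sqW2 hDm hν hfL hgL
  have hFb : ∀ᵐ x ∂ν, |F x| ≤ 4 * M₀ := by
    filter_upwards [hν] with x hx
    rw [abs_of_nonneg (sqW2_nonneg _ _)]
    exact sqW2_le hM.le (hfb x hx) (hgb x hx)
  have hMC := hX.lintegral_average_sub_integral_le hF (by positivity) hFb hN
  have havg : avgSqW2 D ν (law P f) (law P' g) = ∫ x, F x ∂ν := by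
    rw [avgSqW2, Measure.restrict_eq_self_of_ae_mem hν]
  let G : Fin N → (Fin N → Vec n) × (Fin N → Vec d) × (Fin N → Vec d) → ℝ := fun i p =>
    sqW2 (empirical (neighbors p.1 δ (p.1 i)) p.2.1) (empirical (neighbors p.1 δ (p.1 i)) p.2.2)
  have hG : ∀ i, Measurable (G i) := fun i =>
    measurable_comp_neighbors (T := (Fin N → Vec n) × (Fin N → Vec d) × (Fin N → Vec d))
      (Ψ := fun s p => sqW2 (empirical s p.2.1) (empirical s p.2.2))
      (fun s => (continuous_W2_empirical.measurable.comp measurable_snd).ennreal_toReal.pow_const 2)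
      measurable_fst δ i
  let Z : Ω → (Fin N → Vec n) × (Fin N → Vec d) × (Fin N → Vec d) := fun a =>
    (fun i => X i a, fun i => f (X i a) (W i a), fun i => g (X i a) (W' i a))
  have hYm : ∀ i, AEMeasurable (fun a => f (X i a) (W i a)) Pr := fun i =>
    hf.comp_aemeasurable (hX.hasLaw i).aemeasurable
  have hYm' : ∀ i, AEMeasurable (fun a => g (X i a) (W' i a)) Pr := fun i =>
    hg.comp_aemeasurable (hX'.hasLaw i).aemeasurable
  have hZ : AEMeasurable Z Pr :=
    (aemeasurable_pi_lambda _ fun i : Fin N => hX.aemeasurable_fst i).prodMk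
      ((aemeasurable_pi_lambda _ fun i : Fin N => hYm i).prodMk
        (aemeasurable_pi_lambda _ fun i : Fin N => hYm' i))
  have hD : ∀ᵐ a ∂Pr, ∀ i : Fin N, X i a ∈ D := ae_all_iff.2 fun i => hX.ae_mem hν i
  have hY : ∀ᵐ a ∂Pr, ∀ i : Fin N, ‖f (X i a) (W i a)‖ ^ 2 ≤ M₀ :=
    ae_all_iff.2 fun i => hX.ae_norm_le hν hf hfM i
  have hY' : ∀ᵐ a ∂Pr, ∀ i : Fin N, ‖g (X i a) (W' i a)‖ ^ 2 ≤ M₀ :=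
    ae_all_iff.2 fun i => hX'.ae_norm_le hν hg hgM i
  have hgap : ∀ᵐ a ∂Pr, gap D ν P P' f g X W W' δ N a =
      |∫ x, F x ∂ν - (N : ℝ)⁻¹ * ∑ i, G i (Z a)| := by
    filter_upwards [hD] with a ha
    rw [gap, havg, localLoss, setIntegral_inputMeasure (X := fun i : Fin N => X i a) ha]
  -- When all inputs lie in D, which is almost sure, the gap is a measurable function of the data.
  have hgapm : AEMeasurable (gap D ν P P' f g X W W' δ N) Pr := by
    have h0 : Measurable fun p => |∫ x, F x ∂ν - (N : ℝ)⁻¹ * ∑ i, G i p| :=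
      (((Finset.measurable_fun_sum _ fun i _ => hG i).const_mul _).const_sub _).abs
    exact (h0.comp_aemeasurable hZ).congr (hgap.mono fun a ha => ha.symm)
  set K : ℝ := (N : ℝ)⁻¹ * (4 * √M₀) with hK
  have hK0 : 0 ≤ K := by positivity
  set R : Fin N → ℝ := fun i =>
    ∫ a, H (nbrCount (fun j : Fin N => X j a) δ (X i a)) ∂Pr with hR
  have hR0 : ∀ i, 0 ≤ R i := fun i =>
    integral_nonneg fun a => hHnn _ (nbrCount_self_pos (fun j : Fin N => X j a) hδ i)
  have hRint : ∀ i : Fin N,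
      ∫⁻ a, ENNReal.ofReal (σ 0 * (C * H (nbrCount (fun j : Fin N => X j a) δ (X i a)))) ∂Pr =
        ENNReal.ofReal (σ 0 * (C * R i)) := by
    intro i
    rw [hR, ← integral_const_mul, ← integral_const_mul, ofReal_integral_eq_lintegral_ofReal]
    · exact ((integrable_comp_nbrCount hX.aemeasurable_fst H δ i).const_mul _).const_mul _
    · exact Filter.Eventually.of_forall fun a => mul_nonneg (hσ 0).le (mul_nonneg hC.le
        (hHnn _ (nbrCount_self_pos (fun j : Fin N => X j a) hδ i)))
  have hpt : ∀ᵐ a ∂Pr, ‖gap D ν P P' f g X W W' δ N a‖ₑ ≤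
      ‖(N : ℝ)⁻¹ * ∑ i : Fin N, F (X i a) - ∫ x, F x ∂ν‖ₑ +
        (ENNReal.ofReal (8 * √M₀ * L * δ) + ∑ i, ENNReal.ofReal K * (V i a + V' i a)) := by
    filter_upwards [hgap, hD, hY, hY'] with a hga hDa hYa hYa'
    -- A majorant may be infinite at some sample; the claimed bound is then trivial, since the
    -- right-hand side is ∞ (as K > 0).
    by_cases htop : ∀ i, V i a ≠ ∞ ∧ V' i a ≠ ∞
    · have hloc : ∀ i : Fin N, |F (X i a) - G i (Z a)| ≤
          4 * √M₀ * (2 * (L * δ) + ((V i a).toReal + (V' i a).toReal)) := by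
        intro i
        refine (abs_sqW2_sub_sqW2_empirical_le (X := fun j : Fin N => X j a) hfb hgb hL hfL hgL hδ
          hDa hYa hYa' i).trans ?_
        gcongr
        · exact (htop i).1
        · exact hVle i a
        · exact (htop i).2
        · exact hVle' i a
      have hreal : |∫ x, F x ∂ν - (N : ℝ)⁻¹ * ∑ i, G i (Z a)| ≤
          |(N : ℝ)⁻¹ * ∑ i : Fin N, F (X i a) - ∫ x, F x ∂ν| +
          (8 * √M₀ * L * δ + ∑ i, K * ((V i a).toReal + (V' i a).toReal)) := by
        calc _ ≤ |∫ x, F x ∂ν - (N : ℝ)⁻¹ * ∑ i : Fin N, F (X i a)| +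
              |(N : ℝ)⁻¹ * ∑ i : Fin N, F (X i a) - (N : ℝ)⁻¹ * ∑ i, G i (Z a)| :=
              abs_sub_le _ _ _
          _ ≤ |(N : ℝ)⁻¹ * ∑ i : Fin N, F (X i a) - ∫ x, F x ∂ν| +
              (N : ℝ)⁻¹ * ∑ i : Fin N,
                4 * √M₀ * (2 * (L * δ) + ((V i a).toReal + (V' i a).toReal)) := by
              rw [abs_sub_comm, ← mul_sub, ← Finset.sum_sub_distrib, abs_mul,
                abs_of_pos (inv_pos.2 hN')]
              gcongr
              exact (Finset.abs_sum_le_sum_abs _ _).trans (Finset.sum_le_sum fun i _ => hloc i)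
          _ = _ := by
              congr 1
              simp only [mul_add (4 * √M₀), Finset.sum_add_distrib, Finset.sum_const,
                Finset.card_univ, Fintype.card_fin, nsmul_eq_mul, hK, ← Finset.mul_sum]
              field_simp
              ring
      rw [hga, Real.enorm_eq_ofReal_abs, abs_abs]
      refine (ENNReal.ofReal_le_ofReal hreal).trans ?_
      rw [ENNReal.ofReal_add (abs_nonneg _) (by positivity),
        ENNReal.ofReal_add (by positivity) (by positivity),
        ENNReal.ofReal_sum_of_nonneg fun i _ => by positivity, Real.enorm_eq_ofReal_abs]
      gcongr with i
      rw [ENNReal.ofReal_mul hK0, ENNReal.ofReal_add ENNReal.toReal_nonneg ENNReal.toReal_nonneg,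
        ENNReal.ofReal_toReal (htop i).1, ENNReal.ofReal_toReal (htop i).2]
    · push Not at htop
      obtain ⟨i, hi⟩ := htop
      have hKpos : ENNReal.ofReal K ≠ 0 := by
        have : 0 < K := by have := Real.sqrt_pos.2 hM; positivity
        simpa using this
      have hterm : ENNReal.ofReal K * (V i a + V' i a) = ∞ := by
        have : V i a + V' i a = ∞ := by
          by_cases h : V i a = ∞
          · simp [h]
          · simp [hi h]
        rw [this, ENNReal.mul_top hKpos]
      have hsum : ∑ i, ENNReal.ofReal K * (V i a + V' i a) = ∞ :=
        top_le_iff.1 (hterm.symm.le.trans (Finset.single_le_sum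
          (f := fun i => ENNReal.ofReal K * (V i a + V' i a)) (fun _ _ => zero_le)
          (Finset.mem_univ i)))
      rw [hsum]
      simp
  set B : ℝ := 4 * M₀ / √N + 8 * C * M₀ * expectedRate Pr D X δ N H + 8 * √M₀ * L * δ with hB
  have hER := expectedRate_eq hX hν δ N H
  have hE0 : 0 ≤ expectedRate Pr D X δ N H := by
    rw [hER]; exact mul_nonneg (by positivity) (Finset.sum_nonneg fun i _ => hR0 i)
  have hB0 : 0 ≤ B := by positivity
  have hVV : ∀ i, AEMeasurable (fun a => ENNReal.ofReal K * (V i a + V' i a)) Pr := fun i =>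
    ((hVm i).add (hVm' i)).const_mul _
  have htotal : ∫⁻ a, ‖gap D ν P P' f g X W W' δ N a‖ₑ ∂Pr ≤ ENNReal.ofReal B := by
    calc _ ≤ ∫⁻ a, (‖(N : ℝ)⁻¹ * ∑ i : Fin N, F (X i a) - ∫ x, F x ∂ν‖ₑ +
          (ENNReal.ofReal (8 * √M₀ * L * δ) + ∑ i, ENNReal.ofReal K * (V i a + V' i a))) ∂Pr :=
          lintegral_mono_ae hpt
      _ = ∫⁻ a, ‖(N : ℝ)⁻¹ * ∑ i : Fin N, F (X i a) - ∫ x, F x ∂ν‖ₑ ∂Pr +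
          (ENNReal.ofReal (8 * √M₀ * L * δ) +
            ∑ i, ENNReal.ofReal K * (∫⁻ a, V i a ∂Pr + ∫⁻ a, V' i a ∂Pr)) := by
          have hsum : AEMeasurable (fun a => ∑ i, ENNReal.ofReal K * (V i a + V' i a)) Pr :=
            Finset.aemeasurable_fun_sum _ fun i _ => hVV i
          rw [lintegral_add_right' _ (hsum.const_add _),
            lintegral_add_left measurable_const, lintegral_const, measure_univ, mul_one,
            lintegral_finsetSum' _ fun i _ => hVV i]
          congr 2
          refine Finset.sum_congr rfl fun i _ => ?_
          have hadd : AEMeasurable (fun a => V i a + V' i a) Pr := (hVm i).add (hVm' i)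
          rw [lintegral_const_mul'' _ hadd, lintegral_add_left' (hVm i)]
      _ ≤ ENNReal.ofReal (4 * M₀ / √N) + (ENNReal.ofReal (8 * √M₀ * L * δ) +
            ∑ i, ENNReal.ofReal (K * (σ 0 * (C * R i) + σ 0 * (C * R i)))) := by
          refine add_le_add hMC (add_le_add le_rfl (Finset.sum_le_sum fun i _ => ?_))
          have hnn : 0 ≤ σ 0 * (C * R i) := mul_nonneg (hσ 0).le (mul_nonneg hC.le (hR0 i))
          rw [ENNReal.ofReal_mul hK0, ENNReal.ofReal_add hnn hnn, ← hRint i]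
          exact mul_le_mul' le_rfl (add_le_add (hVint i) (hVint' i))
      _ = ENNReal.ofReal (4 * M₀ / √N + (8 * √M₀ * L * δ +
            ∑ i, K * (σ 0 * (C * R i) + σ 0 * (C * R i)))) := by
          have hnn : ∀ i ∈ Finset.univ, 0 ≤ K * (σ 0 * (C * R i) + σ 0 * (C * R i)) := fun i _ => by
            have := mul_nonneg (hσ 0).le (mul_nonneg hC.le (hR0 i))
            positivity
          rw [ENNReal.ofReal_add (by positivity)
              (add_nonneg (by positivity) (Finset.sum_nonneg hnn)),
            ENNReal.ofReal_add (by positivity) (Finset.sum_nonneg hnn),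
            ENNReal.ofReal_sum_of_nonneg hnn]
      _ ≤ ENNReal.ofReal B := by
          refine ENNReal.ofReal_le_ofReal ?_
          have e : ∑ i, K * (σ 0 * (C * R i) + σ 0 * (C * R i)) =
              8 * C * (√M₀ * σ 0) * expectedRate Pr D X δ N H := by
            rw [hER, ← Finset.mul_sum, Finset.sum_add_distrib, ← Finset.mul_sum, ← Finset.mul_sum,
              hK]
            ring
          -- The assumption σ₁ ≤ √M₀ enters here and turns the scale σ₁ of the transport bound into
          -- M₀.
          have hsM : √M₀ * σ 0 ≤ M₀ := by
            calc √M₀ * σ 0 ≤ √M₀ * √M₀ := by gcongr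
              _ = M₀ := Real.mul_self_sqrt hM.le
          have : 8 * C * (√M₀ * σ 0) * expectedRate Pr D X δ N H ≤
              8 * C * M₀ * expectedRate Pr D X δ N H := by gcongr
          rw [e, hB]
          linarith
  have hgi : Integrable (gap D ν P P' f g X W W' δ N) Pr :=
    ⟨hgapm.aestronglyMeasurable, htotal.trans_lt ENNReal.ofReal_lt_top⟩
  refine ⟨hgi, ?_⟩
  rw [← ENNReal.ofReal_le_ofReal_iff hB0]
  refine (ENNReal.ofReal_le_ofReal (le_abs_self _)).trans ?_
  rw [← Real.enorm_eq_ofReal_abs]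
  exact (enorm_integral_le_lintegral_enorm _).trans htotal

end Main

end RandomField
-- The theorem: both rates inserted into the final estimate.
theorem theorem2p3 (d : ℕ) [NeZero d] :
    ∃ C : ℝ, 0 < C ∧
    ∀ σ : Fin d → ℝ, Antitone σ → (∀ i, 0 < σ i) →
    ∃ m₀ : ℕ,
    ∀ (n : ℕ) (D : Set (RandomField.Vec n)), Bornology.IsBounded D → MeasurableSet D →
    ∀ (ν : Measure (RandomField.Vec n)) [IsProbabilityMeasure ν], (∀ᵐ x ∂ν, x ∈ D) →
    -- the two random fields `y_x = f(x; w)` and `ŷ_x = g(x; w')`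
    ∀ (S S' : Type*) [MeasurableSpace S] [MeasurableSpace S']
      (P : Measure S) [IsProbabilityMeasure P] (P' : Measure S') [IsProbabilityMeasure P']
      (f : RandomField.Vec n → S → RandomField.Vec d)
      (g : RandomField.Vec n → S' → RandomField.Vec d),
    Measurable (Function.uncurry f) → Measurable (Function.uncurry g) →
    ∀ M₀ : ℝ,
    (∀ x ∈ D, ∀ᵐ w ∂P, ‖f x w‖ ^ 2 ≤ M₀) → (∀ x ∈ D, ∀ᵐ w ∂P', ‖g x w‖ ^ 2 ≤ M₀) →
    -- `σᵢ` bounds the sixth moments of the `i`-th coordinates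
    (∀ x ∈ D, ∀ i, RandomField.coordMoment (RandomField.law P f x) i ≤ σ i) →
    (∀ x ∈ D, ∀ i, RandomField.coordMoment (RandomField.law P' g x) i ≤ σ i) →
    σ 0 ≤ √M₀ →
    ∀ L : ℝ, 0 ≤ L →
    (∀ x ∈ D, ∀ z ∈ D, RandomField.W2 (RandomField.law P f x) (RandomField.law P f z)
      ≤ ENNReal.ofReal (L * ‖x - z‖)) →
    (∀ x ∈ D, ∀ z ∈ D, RandomField.W2 (RandomField.law P' g x) (RandomField.law P' g z)
      ≤ ENNReal.ofReal (L * ‖x - z‖)) →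
    -- the training data and the samples of the second field at the same inputs
    ∀ (Ω : Type*) [MeasurableSpace Ω] (Pr : Measure Ω) [IsProbabilityMeasure Pr]
      (X : ℕ → Ω → RandomField.Vec n) (W : ℕ → Ω → S) (W' : ℕ → Ω → S'),
    RandomField.IsIIDSample Pr ν P X W → RandomField.IsIIDSample Pr ν P' X W' →
    ∀ δ : ℝ, 0 < δ → ∀ N : ℕ, 1 ≤ N →
      Integrable (RandomField.gap D ν P P' f g X W W' δ N) Pr ∧
      ∫ a, RandomField.gap D ν P P' f g X W W' δ N a ∂Pr ≤
        4 * M₀ / √N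
          + 8 * C * M₀ * RandomField.expectedRate Pr D X δ N (RandomField.rate σ)
          + 8 * √M₀ * L * δ ∧
      ∫ a, RandomField.gap D ν P P' f g X W W' δ N a ∂Pr ≤
        4 * M₀ / √N
          + 8 * C * M₀ * RandomField.expectedRate Pr D X δ N (RandomField.improvedRate σ m₀)
          + 8 * √M₀ * L * δ := by
  obtain ⟨C, hC, hscales⟩ := RandomField.exists_scales d
  refine ⟨C, hC, fun σ hanti hσ => ?_⟩
  obtain ⟨m₀, hm₀⟩ := hscales σ hanti hσ
  refine ⟨m₀, ?_⟩
  intro n D _ hDm ν _ hν S S' _ _ P _ P' _ f g hf hg M₀ hfM hgM hfσ hgσ hσM L hL hfL hgL Ω _ Pr _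
    X W W' hX hX' δ hδ N hN
  have key := fun (h : ℕ → ℝ) hh =>
    RandomField.integrable_gap_and_integral_gap_le hσ hC (hm₀ h hh) hDm hν hf hg hfM hgM hfσ hgσ hσM
      hL hfL hgL hX hX' hδ hN
  exact ⟨(key _ (Or.inl rfl)).1, (key _ (Or.inl rfl)).2, (key _ (Or.inr rfl)).2⟩
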